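/- Let $M$ be a compact connected orientable smooth surface without boundary, with a smooth area form $\omega$ normalized by $\int_M\omega=1$. Let $r\in\{1,2,\dots,\infty\}$, let $H:M\times\mathbb R\to\mathbb R$ be a $C^{r+1}$ function with $H(x,t+1)=H(x,t)$, and let $X_t$ be its time-dependent Hamiltonian vector field, defined by $\omega(v,X_t)=dH(\cdot,t)(v)$ for all tangent vectors $v$. Let $f:M\to M$ be the Poincaré map of its flow from time $t_0$ to time $t_0+1$, for some $t_0\in\mathbb R$ (that is, $f$ is a Hamiltonian diffeomorphism, the time-one map of a 1-periodic Hamiltonian flow). Then $f$ has zero flux: for every closed curve $l$ in $M$, and more generally for every integral 1-cycle $l$ made of $C^1$ curves $[0,1]\to M$, the flux $$F_f(l)=\int_D\omega \bmod 1\in\mathbb R/\mathbb Z,\qquad \partial D=f(l)-l,$$ is well defined and equal to $0$. Explicitly, there is a $C^1$ singular 2-chain $D$ with $\partial D=f(l)-l$, and every such $D$ satisfies $\int_D\omega\in\mathbb Z$. In particular all components of the flux vector of $f$ (the fluxes across the closed curves of a basis of $H_1(M)$) are zero. Here singular chains are integral and cubical, that is, integer combinations of $C^1$ maps $[0,1]^k\to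 M$, and boundaries of 2-chains are compared modulo constant curves, as usual for cubical chains. -/

import Mathlib

open Set MeasureTheory Manifold
open scoped ContDiff

noncomputable section

namespace SurfaceFlux

/-- The plane on which surfaces are modelled. -/
abbrev Plane : Type := EuclideanSpace ℝ (Fin 2)

section Forms

variable (M : Type*) [TopologicalSpace M] [ChartedSpace Plane M] [IsManifold (𝓡 2) ∞ M]

/-- An area form on the surface `M`: a smooth, alternating, nondegenerate bilinear form on the
tangent planes (in dimension two such a form is automatically closed, hence symplectic, and it
orients `M`). -/
structure AreaForm where
  toFun : ∀ x : M, TangentSpace (𝓡 2) x →L[ℝ] TangentSpace (𝓡 2) x →L[ℝ] ℝ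
  alternating : ∀ (x : M) (v : TangentSpace (𝓡 2) x), toFun x v v = 0
  nondegenerate : ∀ (x : M) (v : TangentSpace (𝓡 2) x), (∀ w, toFun x v w = 0) → v = 0
  contMDiff : ContMDiff (𝓡 2) ((𝓡 2).prod 𝓘(ℝ, Plane →L[ℝ] Plane →L[ℝ] ℝ)) ∞
    (fun x ↦ Bundle.TotalSpace.mk' (Plane →L[ℝ] Plane →L[ℝ] ℝ)
      (E := fun x : M ↦ TangentSpace (𝓡 2) x →L[ℝ] TangentSpace (𝓡 2) x →L[ℝ] ℝ) x (toFun x))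

variable {M}

/-- The area element of `Ω` in the coordinates `(u₁, u₂)` of the preferred chart at `x`:
`|Ω(∂/∂u₁, ∂/∂u₂)|`, as a function of the coordinates. -/
def areaDensity (Ω : AreaForm M) (x : M) (u : Plane) : ℝ :=
  |Ω.toFun ((extChartAt (𝓡 2) x).symm u)
    (mfderiv 𝓘(ℝ, Plane) (𝓡 2) (extChartAt (𝓡 2) x).symm u (EuclideanSpace.single 0 (1 : ℝ)))
    (mfderiv 𝓘(ℝ, Plane) (𝓡 2) (extChartAt (𝓡 2) x).symm u (EuclideanSpace.single 1 (1 : ℝ)))|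

/-- The area measure of `Ω` on the domain of the preferred chart at `x` (and zero outside). -/
def chartArea [MeasurableSpace M] (Ω : AreaForm M) (x : M) : Measure M :=
  (((volume : Measure Plane).restrict (extChartAt (𝓡 2) x).target).withDensity
    (fun u ↦ ENNReal.ofReal (areaDensity Ω x u))).map (extChartAt (𝓡 2) x).symm

/-- The area measure `μ` of `Ω`. The measures `chartArea Ω x` agree on the overlaps of the charts,
and their supremum is the measure on `M` that restricts to each of them. -/
def areaMeasure [MeasurableSpace M] (Ω : AreaForm M) : Measure M :=
  ⨆ x : M, chartArea Ω x

/-- The Hamiltonian vector field `J dh` of `h : M → ℝ`, determined by `Ω(v, J dh) = dh(v)` for all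
`v`; see `apply_hamiltonianVectorField`. Since `Ω` is alternating this says `Ω(J dh, ·) = -dh`. -/
def hamiltonianVectorField (Ω : AreaForm M) (h : M → ℝ) (x : M) : TangentSpace (𝓡 2) x :=
  -(Ω.toFun x).inverse (mfderiv (𝓡 2) 𝓘(ℝ, ℝ) h x)

theorem AreaForm.neg_flip (Ω : AreaForm M) (x : M) (v w : TangentSpace (𝓡 2) x) :
    Ω.toFun x v w = -Ω.toFun x w v := by
  have h := Ω.alternating x (v + w)
  simp only [map_add, add_apply, Ω.alternating] at h
  linarith

theorem apply_hamiltonianVectorField (Ω : AreaForm M) (h : M → ℝ) (x : M)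
    (v : TangentSpace (𝓡 2) x) :
    Ω.toFun x v (hamiltonianVectorField Ω h x) = mfderiv (𝓡 2) 𝓘(ℝ, ℝ) h x v := by
  let A : Plane →L[ℝ] (Plane →L[ℝ] ℝ) := Ω.toFun x
  have hinj : Function.Injective A := by
    refine (injective_iff_map_eq_zero A).2 fun w hw ↦ Ω.nondegenerate x w fun z ↦ ?_
    exact congrArg (fun B : Plane →L[ℝ] ℝ ↦ B z) hw
  have hdim : Module.finrank ℝ Plane = Module.finrank ℝ (Plane →L[ℝ] ℝ) := by
    rw [← (LinearMap.toContinuousLinearMap (𝕜 := ℝ) (E := Plane) (F' := ℝ)).finrank_eq]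
    exact (Subspace.dual_finrank_eq (K := ℝ) (V := Plane)).symm
  let e : Plane ≃L[ℝ] (Plane →L[ℝ] ℝ) :=
    (LinearEquiv.ofInjectiveOfFinrankEq (A : Plane →ₗ[ℝ] _) hinj hdim).toContinuousLinearEquiv
  have he : A = (e : Plane →L[ℝ] (Plane →L[ℝ] ℝ)) := by
    ext w z; rfl
  let L : Plane →L[ℝ] ℝ := mfderiv (𝓡 2) 𝓘(ℝ, ℝ) h x
  have hAL : A (A.inverse L) = L := by
    rw [he, ContinuousLinearMap.inverse_equiv]
    exact e.apply_symm_apply L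
  rw [Ω.neg_flip]
  change -(A (-(A.inverse L))) v = L v
  rw [map_neg, hAL]
  exact neg_neg (L v)

/-- `φ t x` is the position at time `t₀ + t` of the trajectory of the time-dependent Hamiltonian
vector field `J dH(·, s)` that is at `x` at time `s = t₀`. -/
def IsHamiltonianFlow (Ω : AreaForm M) (H : M × ℝ → ℝ) (t₀ : ℝ) (φ : ℝ → M → M) : Prop :=
  (∀ x, φ 0 x = x) ∧
  ∀ x t, HasMFDerivAt 𝓘(ℝ, ℝ) (𝓡 2) (fun τ ↦ φ τ x) t
    ((1 : ℝ →L[ℝ] ℝ).smulRight (hamiltonianVectorField Ω (fun y ↦ H (y, t₀ + t)) (φ t x)))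

/-- `f` is the time-one map (Poincaré map of the section `M × {t₀}`) of the Hamiltonian flow of a
Hamiltonian of class `C^(r+1)` on `M × ℝ` that is 1-periodic in time. -/
def IsHamiltonianDiffeo (Ω : AreaForm M) (r : ℕ∞) (f : M → M) : Prop :=
  ∃ (H : M × ℝ → ℝ) (t₀ : ℝ) (φ : ℝ → M → M),
    ContMDiff ((𝓡 2).prod 𝓘(ℝ, ℝ)) 𝓘(ℝ, ℝ) ((r + 1 : ℕ∞) : WithTop ℕ∞) H ∧
    (∀ x t, H (x, t + 1) = H (x, t)) ∧
    IsHamiltonianFlow Ω H t₀ φ ∧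
    f = φ 1

end Forms

section Chains

variable {M : Type*}

/-- Singular (cubical) integral 1-chains: formal combinations of maps `[0,1] → M`. -/
abbrev Chain₁ (M : Type*) : Type _ := (unitInterval → M) →₀ ℤ

/-- Singular (cubical) integral 2-chains: formal combinations of maps `[0,1]² → M`. -/
abbrev Chain₂ (M : Type*) : Type _ := (unitInterval × unitInterval → M) →₀ ℤ

/-- The boundary `γ(1) - γ(0)`, extended linearly to 1-chains. -/
def boundary₁ : Chain₁ M →+ (M →₀ ℤ) :=
  Finsupp.liftAddHom fun γ ↦
    Finsupp.singleAddHom (γ 1) - Finsupp.singleAddHom (γ 0)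

/-- The counterclockwise boundary
`q(s, 0) + q(1, t) - q(s, 1) - q(0, t)`, extended linearly to 2-chains. -/
def boundary₂ : Chain₂ M →+ Chain₁ M :=
  Finsupp.liftAddHom fun q ↦
    Finsupp.singleAddHom (fun s ↦ q (s, 0)) + Finsupp.singleAddHom (fun t ↦ q (1, t))
      - Finsupp.singleAddHom (fun s ↦ q (s, 1)) - Finsupp.singleAddHom (fun t ↦ q (0, t))

/-- The degenerate 1-chains: combinations of constant curves. As usual for cubical chains,
1-chains are compared modulo these. -/
def degenerate₁ (M : Type*) : AddSubgroup (Chain₁ M) :=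
  AddSubgroup.closure (range fun x : M ↦ Finsupp.single (fun _ : unitInterval ↦ x) (1 : ℤ))

/-- The image `f(c)` of a 1-chain under a map `f`. -/
def pushforward₁ (f : M → M) (c : Chain₁ M) : Chain₁ M :=
  c.mapDomain fun γ ↦ f ∘ γ

/-- A map on the closed unit square, as a function on the plane (only the values on
`[0,1] × [0,1]` matter). -/
def extendSquare (q : unitInterval × unitInterval → M) (p : ℝ × ℝ) : M :=
  q (projIcc 0 1 zero_le_one p.1, projIcc 0 1 zero_le_one p.2)

variable [TopologicalSpace M] [ChartedSpace Plane M]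

/-- The curve `γ : [0,1] → M` is of class `C¹` (up to the end points). -/
def IsC1Curve (γ : unitInterval → M) : Prop :=
  ContMDiffOn 𝓘(ℝ, ℝ) (𝓡 2) 1 (IccExtend zero_le_one γ) (Icc (0 : ℝ) 1)

/-- The map `q : [0,1]² → M` is of class `C¹` (up to the boundary). -/
def IsC1Square (q : unitInterval × unitInterval → M) : Prop :=
  ContMDiffOn 𝓘(ℝ, ℝ × ℝ) (𝓡 2) 1 (extendSquare q) (Icc (0 : ℝ) 1 ×ˢ Icc (0 : ℝ) 1)

/-- A `C¹` 1-cycle. -/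
def IsC1Cycle (c : Chain₁ M) : Prop :=
  (∀ γ ∈ c.support, IsC1Curve γ) ∧ boundary₁ c = 0

/-- A closed curve of class `C¹` is a 1-cycle. -/
theorem isC1Cycle_of_closed {l : unitInterval → M} (hl : IsC1Curve l) (h : l 0 = l 1) :
    IsC1Cycle (Finsupp.single l 1) := by
  refine ⟨fun γ hγ ↦ ?_, ?_⟩
  · rwa [show γ = l by simpa using Finsupp.support_single_subset hγ]
  · simp [boundary₁, h]

/-- `D` is a `C¹` 2-chain with `∂D = f(c) - c`. -/
def IsFilling (f : M → M) (c : Chain₁ M) (D : Chain₂ M) : Prop :=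
  (∀ q ∈ D.support, IsC1Square q) ∧
  boundary₂ D - (pushforward₁ f c - c) ∈ degenerate₁ M

variable [IsManifold (𝓡 2) ∞ M]

/-- `∫_q Ω = ∫∫ Ω(∂q/∂s, ∂q/∂t) ds dt` for a `C¹` map `q : [0,1]² → M`. -/
def squareIntegral (Ω : AreaForm M) (q : unitInterval × unitInterval → M) : ℝ :=
  ∫ p in Icc (0 : ℝ) 1 ×ˢ Icc (0 : ℝ) 1,
    Ω.toFun (extendSquare q p)
      (mfderivWithin 𝓘(ℝ, ℝ × ℝ) (𝓡 2) (extendSquare q) (Icc (0 : ℝ) 1 ×ˢ Icc (0 : ℝ) 1) p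
        ((1, 0) : ℝ × ℝ))
      (mfderivWithin 𝓘(ℝ, ℝ × ℝ) (𝓡 2) (extendSquare q) (Icc (0 : ℝ) 1 ×ˢ Icc (0 : ℝ) 1) p
        ((0, 1) : ℝ × ℝ))

/-- `∫_D Ω` for a 2-chain `D`. -/
def chainIntegral (Ω : AreaForm M) (D : Chain₂ M) : ℝ :=
  D.sum fun q n ↦ (n : ℝ) * squareIntegral Ω q

/-- The flux of `f` across the 1-cycle `c` is well defined and equal to `v ∈ ℝ/ℤ`: there is a
2-chain `D` with `∂D = f(c) - c`, and `∫_D Ω mod 1 = v` for every such `D`. -/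
def HasFlux (Ω : AreaForm M) (f : M → M) (c : Chain₁ M) (v : UnitAddCircle) : Prop :=
  (∃ D, IsFilling f c D) ∧
  ∀ D, IsFilling f c D → ((chainIntegral Ω D : ℝ) : UnitAddCircle) = v

end Chains

end SurfaceFlux

end

/-! The flow sweeps out a filling of `f(c) - c`: a curve `γ` of the cycle traces the square `Q(s, t)
= φ (1 - t) (γ s)`. Its edges `t = 0` and `t = 1` are `f ∘ γ` and `γ`, and its two remaining edges
are trajectories of the end points of `γ`, which cancel in the sum because `∂c = 0`. Time runs
backwards along `Q`, so `∂Q/∂t = -X` and the defining relation `Ω(v, X) = dH(v)` gives `Ω(∂Q/∂s,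
∂Q/∂t) = -∂(H ∘ Q)/∂s`. Hence the area of `Q` depends only on the end points of `γ`: it is the
difference of the values there of a function on `M`, minus the time integral of `H` along the
trajectory. Summed over a cycle this vanishes (`chainIntegral_mapDomain_sweep`). The squares are
`C¹` because the flow of a `C¹` field is `C¹` (`contMDiff_of_isHamiltonianFlow`).

Any other filling differs from this one by a chain `Z` with degenerate boundary, and it remains to
see that the area of `Z` is an integer (`exists_int_eq_chainIntegral`). This is a degree argument.
In a chart, the area formula turns integration over `Z` into integration against an integer valued
multiplicity function, the signed count of preimages (`exists_multiplicity`). Stokes' theorem for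
forms `a db` with `a`, `b` supported in the chart says that the distributional derivative of this
function is zero, so it is almost everywhere constant near each point (`exists_chainArea_eq`).
Connectedness makes the constant global after correction by the sign of `Ω` in the chart
(`exists_int_mul_measure`), and the area of `Z` is this integer times the total area 1.

Green's theorem is needed for functions that are only `C¹`, since the squares of a filling have no
second derivatives. -/

noncomputable section

namespace SurfaceFlux

open Filter Topology

/-! ### Green's theorem in class `C¹` -/

section Green

/-- Green's theorem on the unit square for the form `A dB`, where `A` and `B` are only `C¹`.  The
functions are assumed continuous on the whole plane for convenience. -/
theorem integral_wedge_eq_boundary {A B As At Bs Bt : ℝ × ℝ → ℝ}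
    (cA : Continuous A) (cB : Continuous B) (cAs : Continuous As) (cAt : Continuous At)
    (cBs : Continuous Bs) (cBt : Continuous Bt)
    (hAs : ∀ s ∈ Ioo (0 : ℝ) 1, ∀ t ∈ Icc (0 : ℝ) 1, HasDerivAt (fun x ↦ A (x, t)) (As (s, t)) s)
    (hBs : ∀ s ∈ Ioo (0 : ℝ) 1, ∀ t ∈ Icc (0 : ℝ) 1, HasDerivAt (fun x ↦ B (x, t)) (Bs (s, t)) s)
    (hAt : ∀ s ∈ Icc (0 : ℝ) 1, ∀ t ∈ Ioo (0 : ℝ) 1, HasDerivAt (fun x ↦ A (s, x)) (At (s, t)) t)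
    (hBt : ∀ s ∈ Icc (0 : ℝ) 1, ∀ t ∈ Ioo (0 : ℝ) 1, HasDerivAt (fun x ↦ B (s, x)) (Bt (s, t)) t) :
    ∫ p in Icc (0 : ℝ) 1 ×ˢ Icc (0 : ℝ) 1, (As p * Bt p - At p * Bs p) =
      (∫ s in (0 : ℝ)..1, A (s, 0) * Bs (s, 0)) + (∫ t in (0 : ℝ)..1, A (1, t) * Bt (1, t))
      - (∫ s in (0 : ℝ)..1, A (s, 1) * Bs (s, 1)) - ∫ t in (0 : ℝ)..1, A (0, t) * Bt (0, t) := by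
  -- The mean value inequality bounds the difference quotients uniformly; this is the domination for
  -- the limit under the integral sign below.
  have bound : ∀ F Fs : ℝ × ℝ → ℝ, Continuous Fs →
      (∀ s ∈ Ioo (0 : ℝ) 1, ∀ t ∈ Icc (0 : ℝ) 1, HasDerivAt (fun x ↦ F (x, t)) (Fs (s, t)) s) →
      ∃ C, ∀ s ∈ Ioo (0 : ℝ) 1, ∀ x ∈ Ioo (0 : ℝ) 1, ∀ t ∈ Icc (0 : ℝ) 1,
        ‖slope (fun x ↦ F (x, t)) s x‖ ≤ C := by
    intro F Fs cFs hF
    obtain ⟨C, hC⟩ := (isCompact_Icc.prod isCompact_Icc).exists_bound_of_continuousOn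
      (s := Icc (0 : ℝ) 1 ×ˢ Icc (0 : ℝ) 1) cFs.continuousOn
    refine ⟨C, fun s hs x hx t ht ↦ ?_⟩
    have := (convex_Ioo (0 : ℝ) 1).norm_image_sub_le_of_norm_hasDerivWithin_le
      (fun y hy ↦ (hF y hy t ht).hasDerivWithinAt)
      (fun y hy ↦ hC (y, t) ⟨Ioo_subset_Icc_self hy, ht⟩) hs hx
    rw [slope_def_module, norm_smul, norm_inv]
    rcases eq_or_ne x s with rfl | hne
    · simpa using (norm_nonneg _).trans (hC (x, t) ⟨Ioo_subset_Icc_self hx, ht⟩)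
    · rw [inv_mul_le_iff₀ (norm_pos_iff.2 (sub_ne_zero.2 hne))]
      linarith
  obtain ⟨CA, hCA⟩ := bound A As cAs hAs
  obtain ⟨CB, hCB⟩ := bound B Bs cBs hBs
  -- The mixed second derivatives of `B` need not exist, so `d(A dB)` cannot be expanded. Instead
  -- `J` is differentiated in `s` through its difference quotients, and the derivative `G` is
  -- integrated back at the end.
  set J : ℝ → ℝ := fun s ↦ ∫ t in (0 : ℝ)..1, A (s, t) * Bt (s, t) with hJ
  set W : ℝ → ℝ := fun s ↦ ∫ t in (0 : ℝ)..1, (As (s, t) * Bt (s, t) - At (s, t) * Bs (s, t))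
    with hW
  set G : ℝ → ℝ := fun s ↦ W s + (A (s, 1) * Bs (s, 1) - A (s, 0) * Bs (s, 0)) with hG
  have cJ : Continuous J := by
    apply intervalIntegral.continuous_parametric_intervalIntegral_of_continuous'
    simp only [Function.uncurry_def]; fun_prop
  have cW : Continuous W := by
    apply intervalIntegral.continuous_parametric_intervalIntegral_of_continuous'
    simp only [Function.uncurry_def]; fun_prop
  have cG : Continuous G := by fun_prop
  have dJ : ∀ s ∈ Ioo (0 : ℝ) 1, HasDerivAt J (G s) s := by
    intro s hs
    have hsI := Ioo_subset_Icc_self hs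
    rw [hasDerivAt_iff_tendsto_slope]
    -- The increment of `A * Bt` splits as `(A x - A s) * Bt x + A s * (Bt x - Bt s)`. Integrating
    -- the second term by parts in `t` moves the derivative from the increment of `B` to `A`, so
    -- that only first derivatives remain in the limit.
    have key : ∀ᶠ x in 𝓝[≠] s, (∫ t in (0 : ℝ)..1, (slope (fun x ↦ A (x, t)) s x * Bt (x, t)
        - At (s, t) * slope (fun x ↦ B (x, t)) s x)) + (A (s, 1) * slope (fun x ↦ B (x, 1)) s x
          - A (s, 0) * slope (fun x ↦ B (x, 0)) s x) = slope J s x := by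
      filter_upwards [nhdsWithin_le_nhds (isOpen_Ioo.mem_nhds hs)] with x hx
      have hxI := Ioo_subset_Icc_self hx
      have parts := intervalIntegral.integral_mul_deriv_eq_deriv_mul_of_hasDerivAt (a := 0) (b := 1)
        (u := fun t ↦ A (s, t)) (v := fun t ↦ B (x, t) - B (s, t)) (u' := fun t ↦ At (s, t))
        (v' := fun t ↦ Bt (x, t) - Bt (s, t)) (by fun_prop) (by fun_prop)
        (fun t ht ↦ hAt s hsI t (by simpa using ht))
        (fun t ht ↦ (hBt x hxI t (by simpa using ht)).sub (hBt s hsI t (by simpa using ht)))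
        (Continuous.intervalIntegrable (by fun_prop) _ _)
        (Continuous.intervalIntegrable (by fun_prop) _ _)
      have e1 : J x - J s = (∫ t in (0 : ℝ)..1, (A (x, t) - A (s, t)) * Bt (x, t))
          + ∫ t in (0 : ℝ)..1, A (s, t) * (Bt (x, t) - Bt (s, t)) := by
        rw [hJ, ← intervalIntegral.integral_sub, ← intervalIntegral.integral_add]
        · congr 1; ext t; ring
        all_goals exact Continuous.intervalIntegrable (by fun_prop) _ _
      have e2 : (∫ t in (0 : ℝ)..1, (slope (fun x ↦ A (x, t)) s x * Bt (x, t)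
          - At (s, t) * slope (fun x ↦ B (x, t)) s x)) =
          (x - s)⁻¹ * ((∫ t in (0 : ℝ)..1, (A (x, t) - A (s, t)) * Bt (x, t))
            - ∫ t in (0 : ℝ)..1, At (s, t) * (B (x, t) - B (s, t))) := by
        rw [← intervalIntegral.integral_sub, ← intervalIntegral.integral_const_mul]
        · congr 1; ext t; simp only [slope_def_module, smul_eq_mul]; ring
        all_goals exact Continuous.intervalIntegrable (by fun_prop) _ _
      rw [e2, slope_def_module J, e1, parts]
      simp only [slope_def_module, smul_eq_mul]
      ring
    refine Tendsto.congr' key (Tendsto.add ?_ ?_)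
    · obtain ⟨KB, hKB⟩ := (isCompact_Icc.prod isCompact_Icc).exists_bound_of_continuousOn
        (s := Icc (0 : ℝ) 1 ×ˢ Icc (0 : ℝ) 1) cBt.continuousOn
      obtain ⟨KA, hKA⟩ := (isCompact_Icc.prod isCompact_Icc).exists_bound_of_continuousOn
        (s := Icc (0 : ℝ) 1 ×ˢ Icc (0 : ℝ) 1) cAt.continuousOn
      refine intervalIntegral.tendsto_integral_filter_of_dominated_convergence
        (fun _ ↦ CA * KB + KA * CB) ?_ ?_ (by simp) ?_
      · refine Eventually.of_forall fun x ↦ Continuous.aestronglyMeasurable ?_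
        simp only [slope_def_module, smul_eq_mul]; fun_prop
      · filter_upwards [nhdsWithin_le_nhds (isOpen_Ioo.mem_nhds hs)] with x hx
        refine Eventually.of_forall fun t ht ↦ ?_
        have htI : t ∈ Icc (0 : ℝ) 1 := Ioc_subset_Icc_self (by simpa using ht)
        have h1 := hCA s hs x hx t htI
        have h2 := hCB s hs x hx t htI
        have h3 := hKB (x, t) ⟨Ioo_subset_Icc_self hx, htI⟩
        have h4 := hKA (s, t) ⟨hsI, htI⟩
        refine (norm_sub_le _ _).trans (add_le_add ?_ ?_)
        · rw [norm_mul]; exact mul_le_mul h1 h3 (norm_nonneg _) ((norm_nonneg _).trans h1)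
        · rw [norm_mul]; exact mul_le_mul h4 h2 (norm_nonneg _) ((norm_nonneg _).trans h4)
      · refine Eventually.of_forall fun t ht ↦ ?_
        have htI : t ∈ Icc (0 : ℝ) 1 := Ioc_subset_Icc_self (by simpa using ht)
        have l1 := (hasDerivAt_iff_tendsto_slope.1 (hAs s hs t htI))
        have l2 := (hasDerivAt_iff_tendsto_slope.1 (hBs s hs t htI))
        have l3 : Tendsto (fun x ↦ Bt (x, t)) (𝓝[≠] s) (𝓝 (Bt (s, t))) :=
          ((by fun_prop : Continuous fun x ↦ Bt (x, t)).tendsto s).mono_left nhdsWithin_le_nhds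
        exact (l1.mul l3).sub (l2.const_mul _)
    · exact ((hasDerivAt_iff_tendsto_slope.1 (hBs s hs 1 (by simp))).const_mul _).sub
        ((hasDerivAt_iff_tendsto_slope.1 (hBs s hs 0 (by simp))).const_mul _)
  have ftc := intervalIntegral.integral_eq_sub_of_hasDerivAt_of_le zero_le_one cJ.continuousOn dJ
    (cG.intervalIntegrable _ _)
  have hGint : ∫ s in (0 : ℝ)..1, G s = (∫ s in (0 : ℝ)..1, W s) +
      ((∫ s in (0 : ℝ)..1, A (s, 1) * Bs (s, 1)) - ∫ s in (0 : ℝ)..1, A (s, 0) * Bs (s, 0)) := by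
    rw [hG, intervalIntegral.integral_add, intervalIntegral.integral_sub]
    all_goals exact Continuous.intervalIntegrable (by fun_prop) _ _
  have hWint : ∫ p in Icc (0 : ℝ) 1 ×ˢ Icc (0 : ℝ) 1, (As p * Bt p - At p * Bs p)
      = ∫ s in (0 : ℝ)..1, W s := by
    rw [Measure.volume_eq_prod, setIntegral_prod]
    · rw [intervalIntegral.integral_of_le zero_le_one, integral_Icc_eq_integral_Ioc]
      congr 1; ext s
      rw [hW]; simp only
      rw [intervalIntegral.integral_of_le zero_le_one, integral_Icc_eq_integral_Ioc]
    · exact ContinuousOn.integrableOn_compact (isCompact_Icc.prod isCompact_Icc)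
        (by fun_prop)
  rw [hWint]
  linarith

end Green

/-! ### Differentiable dependence on initial points in a normed space -/

section LocalFlow

open Metric
open scoped NNReal

variable {E : Type*} [NormedAddCommGroup E] [NormedSpace ℝ E]

/-- A two-sided Grönwall inequality for functions that vanish at time zero. -/
theorem norm_le_of_norm_deriv_le {e e' : ℝ → E} {K c ε : ℝ} (hK : 0 < K) (hc : 0 ≤ c)
    (he : ∀ t ∈ Ioo (-ε) ε, HasDerivAt e (e' t) t) (h0 : e 0 = 0)
    (bound : ∀ t ∈ Ioo (-ε) ε, ‖e' t‖ ≤ K * ‖e t‖ + c) :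
    ∀ t ∈ Ioo (-ε) ε, ‖e t‖ ≤ c * (Real.exp (K * ε) / K) := by
  have fwd : ∀ d d' : ℝ → E, (∀ t ∈ Ioo (-ε) ε, HasDerivAt d (d' t) t) → d 0 = 0 →
      (∀ t ∈ Ioo (-ε) ε, ‖d' t‖ ≤ K * ‖d t‖ + c) → ∀ t ∈ Ioo (-ε) ε, 0 ≤ t →
      ‖d t‖ ≤ c * (Real.exp (K * ε) / K) := by
    intro d d' hd hd0 hb t ht ht0
    have hsub : Icc 0 t ⊆ Ioo (-ε) ε := fun s hs ↦ ⟨by linarith [hs.1, ht.2], by linarith [hs.2, ht.2]⟩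
    have := norm_le_gronwallBound_of_norm_deriv_right_le (f := d) (f' := d') (δ := 0) (K := K)
      (ε := c) (a := 0) (b := t)
      (fun s hs ↦ (hd s (hsub hs)).continuousAt.continuousWithinAt)
      (fun s hs ↦ (hd s (hsub (Ico_subset_Icc_self hs))).hasDerivWithinAt) (by simp [hd0])
      (fun s hs ↦ hb s (hsub (Ico_subset_Icc_self hs))) t ⟨ht0, le_rfl⟩
    refine this.trans ?_
    rw [gronwallBound_of_K_ne_0 hK.ne']
    have h1 : Real.exp (K * (t - 0)) - 1 ≤ Real.exp (K * ε) := by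
      have : Real.exp (K * (t - 0)) ≤ Real.exp (K * ε) := by
        gcongr; linarith [ht.2]
      linarith
    calc 0 * Real.exp (K * (t - 0)) + c / K * (Real.exp (K * (t - 0)) - 1)
        ≤ c / K * Real.exp (K * ε) := by rw [zero_mul, zero_add]; gcongr
      _ = _ := by ring
  intro t ht
  rcases le_total 0 t with h | h
  · exact fwd e e' he h0 bound t ht h
  · have hneg : ∀ s ∈ Ioo (-ε) ε, -s ∈ Ioo (-ε) ε := fun s hs ↦ ⟨by linarith [hs.2], by linarith [hs.1]⟩
    have := fwd (fun s ↦ e (-s)) (fun s ↦ -e' (-s))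
      (fun s hs ↦ by simpa [Function.comp_def] using (he (-s) (hneg s hs)).scomp s (hasDerivAt_neg s))
      (by simp [h0]) (fun s hs ↦ by simpa using bound (-s) (hneg s hs)) (-t) (hneg t ht) (by linarith)
    simpa using this

/-- Linear equations with continuous bounded coefficients are solvable on short intervals. -/
theorem exists_linear_solution [CompleteSpace E] {B : ℝ → E →L[ℝ] E} {K ε : ℝ} (hε : 0 < ε)
    (hB : ContinuousOn B (Icc (-ε) ε)) (hBK : ∀ t ∈ Icc (-ε) ε, ‖B t‖ ≤ K) (hKε : 2 * K * ε ≤ 1)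
    {a₀ : E} (ha₀ : ‖a₀‖ ≤ 1) :
    ∃ A : ℝ → E, A 0 = a₀ ∧ ∀ t ∈ Ioo (-ε) ε, HasDerivAt A (B t (A t)) t := by
  have h0 : (0 : ℝ) ∈ Icc (-ε) ε := ⟨by linarith, hε.le⟩
  have hK0 : 0 ≤ K := (norm_nonneg _).trans (hBK 0 h0)
  -- On the unit ball about `a₀` vectors have norm at most 2, so the field is bounded by `2K`, and
  -- `2Kε ≤ 1` keeps the solution in that ball.
  have pl : IsPicardLindelof (fun t z ↦ B t z) (⟨0, h0⟩ : Icc (-ε) ε) a₀ 1 0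
      (2 * ⟨K, hK0⟩) ⟨K, hK0⟩ := by
    refine ⟨fun t ht ↦ ?_, fun x _ ↦ hB.clm_apply continuousOn_const, fun t ht x hx ↦ ?_, ?_⟩
    · refine ((B t).lipschitz.weaken ?_).lipschitzOnWith
      exact hBK t ht
    · have hx' : ‖x‖ ≤ 2 := by
        have : ‖x - a₀‖ ≤ 1 := by simpa [dist_eq_norm] using hx
        calc ‖x‖ = ‖(x - a₀) + a₀‖ := by simp
          _ ≤ 2 := (norm_add_le _ _).trans (by linarith)
      calc ‖B t x‖ ≤ ‖B t‖ * ‖x‖ := (B t).le_opNorm x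
        _ ≤ K * 2 := mul_le_mul (hBK t ht) hx' (norm_nonneg _) hK0
        _ = _ := by exact mul_comm _ _
    · have e : ((2 * ⟨K, hK0⟩ : ℝ≥0) : ℝ) = 2 * K := rfl
      simpa [e] using hKε
  obtain ⟨A, hA0, hA⟩ := pl.exists_eq_forall_mem_Icc_hasDerivWithinAt₀
  exact ⟨A, hA0, fun t ht ↦ (hA t (Ioo_subset_Icc_self ht)).hasDerivAt (Icc_mem_nhds ht.1 ht.2)⟩

/-- Local flows of `C¹` vector fields are `C¹`, jointly in time and in the initial point. -/
theorem exists_contDiffOn_localFlow [FiniteDimensional ℝ E] {f : E → E} {x₀ : E}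
    (hf : ContDiffAt ℝ 1 f x₀) {U : Set E} (hU : U ∈ 𝓝 x₀) :
    ∃ ρ > 0, ∃ ε > 0, ∃ Ψ : E × ℝ → E, ContDiffOn ℝ 1 Ψ (ball x₀ ρ ×ˢ Ioo (-ε) ε) ∧
      (∀ x ∈ ball x₀ ρ, Ψ (x, 0) = x) ∧
      (∀ x ∈ ball x₀ ρ, ∀ t ∈ Ioo (-ε) ε, HasDerivAt (fun s ↦ Ψ (x, s)) (f (Ψ (x, t))) t) ∧
      ∀ x ∈ ball x₀ ρ, ∀ t ∈ Ioo (-ε) ε, Ψ (x, t) ∈ U := by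
  have : CompleteSpace E := FiniteDimensional.complete ℝ E
  obtain ⟨a, ha, haU⟩ := (nhds_basis_closedBall.mem_iff).1
    (inter_mem hU (hf.eventually (by simp)))
  set S := closedBall x₀ a with hS
  have hSc : IsCompact S := isCompact_closedBall _ _
  have hfS : ∀ x ∈ S, ContDiffAt ℝ 1 f x := fun x hx ↦ (haU hx).2
  have hdS : ∀ x ∈ S, HasFDerivAt f (fderiv ℝ f x) x := fun x hx ↦
    ((hfS x hx).differentiableAt (by simp)).hasFDerivAt
  have hDc : ContinuousOn (fderiv ℝ f) S := fun x hx ↦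
    ((hfS x hx).fderiv_right (m := 0) (by simp)).continuousAt.continuousWithinAt
  obtain ⟨K₀, hK₀⟩ := hSc.exists_bound_of_continuousOn hDc
  set K : ℝ := max K₀ 1 with hKdef
  have hKpos : 0 < K := lt_of_lt_of_le one_pos (le_max_right _ _)
  have hDK : ∀ x ∈ S, ‖fderiv ℝ f x‖ ≤ K := fun x hx ↦ (hK₀ x hx).trans (le_max_left _ _)
  have hDu := hSc.uniformContinuousOn_of_continuous hDc
  rw [Metric.uniformContinuousOn_iff] at hDu
  -- Uniform continuity of the derivative on the compact ball `S` makes the first order Taylor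
  -- remainder uniformly small.
  have hrem : ∀ η > 0, ∃ δ > 0, ∀ u ∈ S, ∀ w ∈ S, ‖w - u‖ < δ →
      ‖f w - f u - fderiv ℝ f u (w - u)‖ ≤ η * ‖w - u‖ := by
    intro η hη
    obtain ⟨δ, hδ, H⟩ := hDu η hη
    refine ⟨δ, hδ, fun u hu w hw huw ↦ ?_⟩
    refine Convex.norm_image_sub_le_of_norm_hasFDerivWithin_le' (s := S ∩ ball u δ)
      (fun y hy ↦ (hdS y hy.1).hasFDerivWithinAt) (fun y hy ↦ ?_)
      ((convex_closedBall _ _).inter (convex_ball _ _)) ⟨hu, mem_ball_self hδ⟩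
      ⟨hw, by simpa [dist_eq_norm] using huw⟩
    rw [← dist_eq_norm]
    exact (H y hy.1 u hu (by simpa using hy.2)).le
  obtain ⟨ε₁, hε₁, a₁, r, L₁, K₁, hr, hpl⟩ := IsPicardLindelof.of_contDiffAt_one hf
  obtain ⟨α, hα, L', hαL⟩ :=
    (hpl 0).exists_forall_mem_closedBall_eq_hasDerivWithinAt_lipschitzOnWith
  simp only [zero_sub, zero_add] at hα hαL
  have hαc : ContinuousOn (Function.uncurry α) (closedBall x₀ r ×ˢ Icc (-ε₁) ε₁) :=
    continuousOn_prod_of_continuousOn_lipschitzOnWith _ L'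
      (fun x hx t ht ↦ ((hα x hx).2 t ht).continuousWithinAt) hαL
  have hα0 : α x₀ 0 = x₀ := (hα x₀ (mem_closedBall_self r.2)).1
  have hnear : ∀ᶠ p in 𝓝 (x₀, (0 : ℝ)), Function.uncurry α p ∈ S := by
    refine (hαc.continuousAt (prod_mem_nhds (closedBall_mem_nhds _ hr)
      (Icc_mem_nhds (by linarith) hε₁))).eventually_mem ?_
    simpa [Function.uncurry, hα0] using closedBall_mem_nhds x₀ ha
  rw [nhds_prod_eq, ((nhds_basis_ball).prod (nhds_basis_Ioo_pos (0 : ℝ))).eventually_iff] at hnear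
  obtain ⟨⟨ρ₀, ε₀⟩, ⟨hρ₀, hε₀⟩, hnear⟩ := hnear
  simp only [zero_sub, zero_add] at hρ₀ hε₀ hnear
  set ρ := min ρ₀ r with hρ
  -- The three bounds keep the trajectories in `S`, keep them within the existence time, and allow
  -- the variational equation to be solved on the whole interval; halving makes the inequalities
  -- strict.
  set ε := min (min ε₀ ε₁) (1 / (2 * K)) / 2 with hε
  have hρpos : 0 < ρ := lt_min hρ₀ hr
  have hmpos : 0 < min (min ε₀ ε₁) (1 / (2 * K)) := lt_min (lt_min hε₀ hε₁) (by positivity)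
  have hεpos : 0 < ε := half_pos hmpos
  have hεlt : ε < min (min ε₀ ε₁) (1 / (2 * K)) := half_lt_self hmpos
  have hεε₀ : ε < ε₀ := hεlt.trans_le ((min_le_left _ _).trans (min_le_left _ _))
  have hεε₁ : ε < ε₁ := hεlt.trans_le ((min_le_left _ _).trans (min_le_right _ _))
  have hKε : 2 * K * ε ≤ 1 := by
    have : ε ≤ 1 / (2 * K) := hεlt.le.trans (min_le_right _ _)
    rw [le_div_iff₀ (by positivity)] at this; linarith
  have hball : ∀ x ∈ ball x₀ ρ, x ∈ closedBall x₀ (r : ℝ) := fun x hx ↦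
    ball_subset_closedBall (ball_subset_ball (min_le_right _ _) hx)
  have hIcc : Icc (-ε) ε ⊆ Icc (-ε₁) ε₁ := Icc_subset_Icc (by linarith) hεε₁.le
  have hαS : ∀ x ∈ ball x₀ ρ, ∀ t ∈ Icc (-ε) ε, α x t ∈ S := fun x hx t ht ↦
    hnear (x := (x, t)) ⟨ball_subset_ball (min_le_left _ _) hx, by
      constructor <;> simp only <;> linarith [ht.1, ht.2]⟩
  have hαd : ∀ x ∈ ball x₀ ρ, ∀ t ∈ Ioo (-ε) ε, HasDerivAt (α x) (f (α x t)) t := fun x hx t ht ↦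
    ((hα x (hball x hx)).2 t (hIcc (Ioo_subset_Icc_self ht))).hasDerivAt
      (Icc_mem_nhds (by linarith [ht.1]) (by linarith [ht.2]))
  have hαi : ∀ x ∈ ball x₀ ρ, α x 0 = x := fun x hx ↦ (hα x (hball x hx)).1
  have hlip : ∀ x ∈ ball x₀ ρ, ∀ y ∈ ball x₀ ρ, ∀ t ∈ Icc (-ε) ε,
      ‖α y t - α x t‖ ≤ L' * ‖y - x‖ := fun x hx y hy t ht ↦ by
    simpa [dist_eq_norm] using (hαL t (hIcc ht)).dist_le_mul y (hball y hy) x (hball x hx)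
  -- the solutions of the variational equation
  have hvar : ∀ x ∈ ball x₀ ρ, ∃ A : ℝ → E →L[ℝ] E, A 0 = ContinuousLinearMap.id ℝ E ∧
      ∀ t ∈ Ioo (-ε) ε, HasDerivAt A ((fderiv ℝ f (α x t)).comp (A t)) t := by
    intro x hx
    have hc : ContinuousOn (fun t ↦ fderiv ℝ f (α x t)) (Icc (-ε) ε) :=
      hDc.comp (fun t ht ↦ ((hα x (hball x hx)).2 t (hIcc ht)).continuousWithinAt.mono hIcc)
        (hαS x hx)
    obtain ⟨A, hA0, hA⟩ := exists_linear_solution (E := E →L[ℝ] E) (K := K)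
      (B := fun t ↦ ContinuousLinearMap.compL ℝ E E E (fderiv ℝ f (α x t))) hεpos
      ((ContinuousLinearMap.compL ℝ E E E).continuous.comp_continuousOn hc)
      (fun t ht ↦ by
        refine (ContinuousLinearMap.opNorm_le_bound _ (norm_nonneg _) fun y ↦ ?_).trans
          (hDK _ (hαS x hx t ht))
        exact ContinuousLinearMap.opNorm_comp_le _ _)
      hKε (ContinuousLinearMap.norm_id_le)
    exact ⟨A, hA0, hA⟩
  choose! A hA0 hA using hvar
  set G := Real.exp (K * ε) / K with hG
  have hGpos : 0 < G := by positivity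
  -- Grönwall is applied to `A x t - id`, which vanishes at time zero and satisfies the variational
  -- equation with forcing term `Df`, of norm at most `K`.
  have hAbd : ∀ x ∈ ball x₀ ρ, ∀ t ∈ Ioo (-ε) ε, ‖A x t‖ ≤ K * G + 1 := by
    intro x hx t ht
    have := norm_le_of_norm_deriv_le (e := fun t ↦ A x t - ContinuousLinearMap.id ℝ E) hKpos
      hKpos.le (fun t ht ↦ (hA x hx t ht).sub_const _) (by simp [hA0 x hx])
      (fun t ht ↦ ?_) t ht
    · calc ‖A x t‖ = ‖(A x t - ContinuousLinearMap.id ℝ E) + ContinuousLinearMap.id ℝ E‖ := by simp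
        _ ≤ K * G + 1 := (norm_add_le _ _).trans (add_le_add this ContinuousLinearMap.norm_id_le)
    · have hD := hDK _ (hαS x hx t (Ioo_subset_Icc_self ht))
      have e : (fderiv ℝ f (α x t)).comp (A x t) = (fderiv ℝ f (α x t)).comp
          (A x t - ContinuousLinearMap.id ℝ E) + fderiv ℝ f (α x t) := by
        ext; simp
      rw [e]
      refine (norm_add_le _ _).trans (add_le_add ?_ hD)
      exact (ContinuousLinearMap.opNorm_comp_le _ _).trans (by gcongr)
  -- The linearization error vanishes at time zero and solves the variational equation forced by the
  -- Taylor remainder of `f`. The constant below cancels the Grönwall factor `G` and the Lipschitz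
  -- constant of the flow, raised by 1 to be positive.
  have hdiff : ∀ η > 0, ∃ δ > 0, ∀ x ∈ ball x₀ ρ, ∀ y ∈ ball x₀ ρ, ‖y - x‖ < δ →
      ∀ t ∈ Ioo (-ε) ε, ‖α y t - α x t - A x t (y - x)‖ ≤ η * ‖y - x‖ := by
    intro η hη
    have hη' : 0 < η / ((L' + 1) * G) := by positivity
    obtain ⟨δ, hδ, H⟩ := hrem _ hη'
    refine ⟨δ / (L' + 1), by positivity, fun x hx y hy hxy t ht ↦ ?_⟩
    rw [lt_div_iff₀ (by positivity)] at hxy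
    have := norm_le_of_norm_deriv_le (e := fun t ↦ α y t - α x t - A x t (y - x)) (K := K)
      (c := η / ((L' + 1) * G) * ((L' + 1) * ‖y - x‖)) (ε := ε) hKpos (by positivity)
      (fun t ht ↦ ((hαd y hy t ht).sub (hαd x hx t ht)).sub
        ((hA x hx t ht).clm_apply (hasDerivAt_const _ _)))
      (by simp [hA0 x hx, hαi x hx, hαi y hy]) (fun t ht ↦ ?_) t ht
    · refine this.trans (le_of_eq ?_)
      rw [← hG]; field_simp
    · have htI := Ioo_subset_Icc_self ht
      have hl := hlip x hx y hy t htI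
      have hl' : ‖α y t - α x t‖ ≤ (L' + 1) * ‖y - x‖ := hl.trans (by gcongr; linarith)
      have hr := H _ (hαS x hx t htI) _ (hαS y hy t htI)
        (hl'.trans_lt (by linarith))
      have e : f (α y t) - f (α x t) - (((fderiv ℝ f (α x t)).comp (A x t)) (y - x) + (A x t) 0)
          = fderiv ℝ f (α x t) (α y t - α x t - A x t (y - x)) +
            (f (α y t) - f (α x t) - fderiv ℝ f (α x t) (α y t - α x t)) := by
        simp only [map_sub, ContinuousLinearMap.comp_apply, map_zero]; abel
      rw [e]
      refine (norm_add_le _ _).trans (add_le_add ?_ (hr.trans (by gcongr)))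
      exact ((fderiv ℝ f (α x t)).le_opNorm _).trans
        (mul_le_mul_of_nonneg_right (hDK _ (hαS x hx t htI)) (norm_nonneg _))
  -- The same argument for `A y - A x`, now forced by the variation of `Df` along the two
  -- trajectories times `A y`, which is bounded by `K * G + 1`.
  have hAcont : ∀ η > 0, ∃ δ > 0, ∀ x ∈ ball x₀ ρ, ∀ y ∈ ball x₀ ρ, ‖y - x‖ < δ →
      ∀ t ∈ Ioo (-ε) ε, ‖A y t - A x t‖ ≤ η := by
    intro η hη
    obtain ⟨δ, hδ, H⟩ := hDu (η / ((K * G + 1) * G)) (by positivity)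
    refine ⟨δ / (L' + 1), by positivity, fun x hx y hy hxy t ht ↦ ?_⟩
    rw [lt_div_iff₀ (by positivity)] at hxy
    have := norm_le_of_norm_deriv_le (e := fun t ↦ A y t - A x t) (K := K)
      (c := η / ((K * G + 1) * G) * (K * G + 1)) (ε := ε) hKpos (by positivity)
      (fun t ht ↦ (hA y hy t ht).sub (hA x hx t ht)) (by simp [hA0 x hx, hA0 y hy])
      (fun t ht ↦ ?_) t ht
    · refine this.trans (le_of_eq ?_)
      rw [← hG]; field_simp
    · have htI := Ioo_subset_Icc_self ht
      have hl := hlip x hx y hy t htI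
      have hl' : ‖α y t - α x t‖ ≤ (L' + 1) * ‖y - x‖ := hl.trans (by gcongr; linarith)
      have hr := H _ (hαS y hy t htI) _ (hαS x hx t htI)
        (by rw [dist_eq_norm]; exact hl'.trans_lt (by linarith))
      rw [dist_eq_norm] at hr
      have e : (fderiv ℝ f (α y t)).comp (A y t) - (fderiv ℝ f (α x t)).comp (A x t)
          = (fderiv ℝ f (α x t)).comp (A y t - A x t) +
            (fderiv ℝ f (α y t) - fderiv ℝ f (α x t)).comp (A y t) := by
        ext; simp
      rw [e]
      refine (norm_add_le _ _).trans (add_le_add ?_ ?_)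
      · exact (ContinuousLinearMap.opNorm_comp_le _ _).trans
          (mul_le_mul_of_nonneg_right (hDK _ (hαS x hx t htI)) (norm_nonneg _))
      · exact (ContinuousLinearMap.opNorm_comp_le _ _).trans
          (mul_le_mul hr.le (hAbd y hy t ht) (norm_nonneg _) (by positivity))
  have hopen : IsOpen (ball x₀ ρ ×ˢ Ioo (-ε) ε) := isOpen_ball.prod isOpen_Ioo
  refine ⟨ρ, hρpos, ε, hεpos, Function.uncurry α, ?_, hαi, hαd,
    fun x hx t ht ↦ (haU (hαS x hx t (Ioo_subset_Icc_self ht))).1⟩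
  have hAc : ContinuousOn (Function.uncurry A) (ball x₀ ρ ×ˢ Ioo (-ε) ε) := by
    rintro ⟨x, t⟩ ⟨hx, ht⟩
    refine ContinuousAt.continuousWithinAt ?_
    rw [Metric.continuousAt_iff']
    intro η hη
    obtain ⟨δ, hδ, H⟩ := hAcont (η / 2) (half_pos hη)
    have h2 : ∀ᶠ s in 𝓝 t, dist (A x s) (A x t) < η / 2 :=
      Metric.continuousAt_iff'.1 (hA x hx t ht).continuousAt _ (half_pos hη)
    have h1 : ∀ᶠ y in 𝓝 x, y ∈ ball x₀ ρ ∩ ball x δ :=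
      inter_mem (isOpen_ball.mem_nhds hx) (ball_mem_nhds _ hδ)
    filter_upwards [h1.prod_nhds (h2.and (isOpen_Ioo.mem_nhds ht))] with p hp
    have := H x hx p.1 hp.1.1 (by simpa [dist_eq_norm] using hp.1.2) p.2 hp.2.2
    calc dist (A p.1 p.2) (A x t) ≤ dist (A p.1 p.2) (A x p.2) + dist (A x p.2) (A x t) :=
          dist_triangle _ _ _
      _ < η / 2 + η / 2 := add_lt_add_of_le_of_lt (by rwa [dist_eq_norm]) hp.2.1
      _ = η := add_halves η
  have hαc' : ContinuousOn (Function.uncurry α) (ball x₀ ρ ×ˢ Ioo (-ε) ε) :=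
    hαc.mono (prod_mono hball (Ioo_subset_Icc_self.trans hIcc))
  have hfc : ContinuousOn (fun p ↦ f (Function.uncurry α p)) (ball x₀ ρ ×ˢ Ioo (-ε) ε) :=
    ContinuousOn.comp (t := S) (fun x hx ↦ (hfS x hx).continuousAt.continuousWithinAt) hαc'
      (fun p hp ↦ hαS p.1 hp.1 p.2 (Ioo_subset_Icc_self hp.2))
  set T : E → ℝ → ℝ →L[ℝ] E := fun x t ↦ (1 : ℝ →L[ℝ] ℝ).smulRight (f (α x t)) with hT
  have hTc : ContinuousOn (Function.uncurry T) (ball x₀ ρ ×ˢ Ioo (-ε) ε) :=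
    (ContinuousLinearMap.smulRightL ℝ ℝ E 1).continuous.comp_continuousOn hfc
  intro p hp
  -- Both partial derivatives, `A` in space and `f ∘ α` in time, exist and are jointly continuous,
  -- which yields joint differentiability.
  refine ContDiffAt.contDiffWithinAt (contDiffAt_one_iff.2
    ⟨fun p ↦ (Function.uncurry A p).coprod (Function.uncurry T p), _, hopen.mem_nhds hp, ?_, ?_⟩)
  · exact hAc.continuousLinearMapCoprod hTc
  · intro p hp
    refine (hasStrictFDerivAt_uncurry_coprod (f := α) (f₁ := A) (f₂ := T) ?_ ?_
      (hAc.continuousAt (hopen.mem_nhds hp)) (hTc.continuousAt (hopen.mem_nhds hp))).hasFDerivAt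
    · filter_upwards [hopen.mem_nhds hp] with q hq
      rw [hasFDerivAt_iff_isLittleO, Asymptotics.isLittleO_iff]
      intro η hη
      obtain ⟨δ, hδ, H⟩ := hdiff η hη
      filter_upwards [isOpen_ball.mem_nhds hq.1, ball_mem_nhds q.1 hδ] with y hy hyδ
      exact H q.1 hq.1 y hy (by simpa [dist_eq_norm] using hyδ) q.2 hq.2
    · filter_upwards [hopen.mem_nhds hp] with q hq
      exact (hαd q.1 hq.1 q.2 hq.2).hasFDerivAt

end LocalFlow

/-! ### Differentiable dependence on parameters on a manifold -/

section ManifoldFlow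

variable {E : Type*} [NormedAddCommGroup E] [NormedSpace ℝ E]
  {H : Type*} [TopologicalSpace H] {I : ModelWithCorners ℝ E H}
  {N : Type*} [TopologicalSpace N] [ChartedSpace H N] [IsManifold I 1 N] [I.Boundaryless]
  {v : (x : N) → TangentSpace I x}

/-- The manifold derivative is read in the chart centred at the moving point, while the equation is
written in the fixed chart at `x₀`. The cocycle rule for `tangentCoordChange` converts one into the
other. -/
theorem hasMFDerivAt_symm_comp_of_hasDerivAt {x₀ : N} {f : ℝ → E} {t : ℝ}
    (hmem : f t ∈ (extChartAt I x₀).target)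
    (h : HasDerivAt f (tangentCoordChange I ((extChartAt I x₀).symm (f t)) x₀
      ((extChartAt I x₀).symm (f t)) (v ((extChartAt I x₀).symm (f t)))) t) :
    HasMFDerivAt 𝓘(ℝ, ℝ) I ((extChartAt I x₀).symm ∘ f) t
      ((1 : ℝ →L[ℝ] ℝ).smulRight (v ((extChartAt I x₀).symm (f t)))) := by
  set xₜ : N := (extChartAt I x₀).symm (f t)
  have hft1 := (extChartAt I x₀).target_subset_preimage_source hmem
  have hft2 := mem_extChartAt_source (I := I) xₜ
  set w : E := v xₜ with hw
  have key : HasDerivAt ((extChartAt I xₜ ∘ (extChartAt I x₀).symm) ∘ f) w t := by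
    rw [← tangentCoordChange_self (I := I) (x := xₜ) (z := xₜ) (v := w) hft2,
      ← tangentCoordChange_comp (x := x₀) ⟨⟨hft2, hft1⟩, hft2⟩]
    refine HasFDerivAt.comp_hasDerivAt t ?_ h
    have h1 := hasFDerivWithinAt_tangentCoordChange (I := I) (x := x₀) (y := xₜ) ⟨hft1, hft2⟩
    rwa [(extChartAt I x₀).right_inv hmem, ModelWithCorners.Boundaryless.range_eq_univ,
      hasFDerivWithinAt_univ] at h1
  refine ⟨(continuousAt_extChartAt_symm'' hmem).comp h.continuousAt, ?_⟩
  have h2 : HasFDerivAt ((extChartAt I xₜ ∘ (extChartAt I x₀).symm) ∘ f)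
      ((1 : ℝ →L[ℝ] ℝ).smulRight w) t := key
  have h3 := h2.hasFDerivWithinAt (s := univ)
  rw [← range_id] at h3
  exact h3

theorem contDiffAt_tangentCoordChange_of_contMDiff
    (hv : ContMDiff I I.tangent 1 (fun x ↦ (⟨x, v x⟩ : TangentBundle I N))) (x₀ : N) :
    ContDiffAt ℝ 1 (fun u ↦ tangentCoordChange I ((extChartAt I x₀).symm u) x₀
      ((extChartAt I x₀).symm u) (v ((extChartAt I x₀).symm u))) (extChartAt I x₀ x₀) := by
  have hv := (contMDiffAt_iff.1 (hv x₀)).2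
  rw [ModelWithCorners.Boundaryless.range_eq_univ, contDiffWithinAt_univ] at hv
  exact hv.snd

/-- A `C¹` vector field on a manifold has `C¹` local flows. -/
theorem exists_contMDiffOn_localFlow [FiniteDimensional ℝ E]
    (hv : ContMDiff I I.tangent 1 (fun x ↦ (⟨x, v x⟩ : TangentBundle I N))) (y₀ : N) :
    ∃ W ∈ 𝓝 y₀, ∃ ε > 0, ∃ Φ : N × ℝ → N,
      ContMDiffOn (I.prod 𝓘(ℝ, ℝ)) I 1 Φ (W ×ˢ Ioo (-ε) ε) ∧
      ∀ y ∈ W, Φ (y, 0) = y ∧ IsMIntegralCurveOn (fun t ↦ Φ (y, t)) v (Ioo (-ε) ε) := by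
  obtain ⟨ρ, hρ, ε, hε, Ψ, hΨ, hΨ0, hΨd, hΨt⟩ :=
    exists_contDiffOn_localFlow (contDiffAt_tangentCoordChange_of_contMDiff hv y₀)
      (extChartAt_target_mem_nhds (I := I) y₀)
  set W : Set N := (extChartAt I y₀).source ∩ (extChartAt I y₀) ⁻¹' Metric.ball (extChartAt I y₀ y₀) ρ
  refine ⟨W, inter_mem (extChartAt_source_mem_nhds y₀)
      ((continuousAt_extChartAt y₀).preimage_mem_nhds (Metric.ball_mem_nhds _ hρ)), ε, hε,
    fun p ↦ (extChartAt I y₀).symm (Ψ (extChartAt I y₀ p.1, p.2)), ?_, fun y hy ↦ ⟨?_, ?_⟩⟩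
  · have h1 : ContMDiffOn (I.prod 𝓘(ℝ, ℝ)) 𝓘(ℝ, E × ℝ) 1
        (fun p : N × ℝ ↦ (extChartAt I y₀ p.1, p.2)) (W ×ˢ Ioo (-ε) ε) :=
      ContMDiffOn.prodMk_space
        ((contMDiffOn_extChartAt (x := y₀)).comp contMDiffOn_fst
          fun p hp ↦ by simpa using hp.1.1) contMDiffOn_snd
    exact (contMDiffOn_extChartAt_symm y₀).comp
      (hΨ.contMDiffOn.comp h1 fun p hp ↦ ⟨hp.1.2, hp.2⟩) fun p hp ↦ hΨt _ hp.1.2 _ hp.2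
  · simp only [hΨ0 _ hy.2, (extChartAt I y₀).left_inv hy.1]
  · intro t ht
    exact (hasMFDerivAt_symm_comp_of_hasDerivAt (v := v)
      (f := fun t ↦ Ψ (extChartAt I y₀ y, t)) (hΨt _ hy.2 t ht) (hΨd _ hy.2 t ht)).hasMFDerivWithinAt

variable {E' : Type*} [NormedAddCommGroup E'] [NormedSpace ℝ E']
  {H' : Type*} [TopologicalSpace H'] {J : ModelWithCorners ℝ E' H'}
  {P : Type*} [TopologicalSpace P] [ChartedSpace H' P]

/-- Integral curves of a `C¹` vector field depend in a `C¹` way on time and on parameters if their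
initial points do. -/
theorem contMDiff_of_isMIntegralCurve [FiniteDimensional ℝ E] [T2Space N]
    (hv : ContMDiff I I.tangent 1 (fun x ↦ (⟨x, v x⟩ : TangentBundle I N)))
    {Γ : ℝ → P → N} (h0 : ContMDiff J I 1 (Γ 0))
    (hΓ : ∀ p, IsMIntegralCurve (fun t ↦ Γ t p) v) :
    ContMDiff (𝓘(ℝ, ℝ).prod J) I 1 (fun z : ℝ × P ↦ Γ z.1 z.2) := by
  -- By uniqueness `Γ t p = Φ (Γ s p, t - s)` for `s`, `t` near `t₀` and `p` near `p₀`. Regularity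
  -- at one time therefore spreads to a whole interval whose size does not depend on that time;
  -- radius `ε / 2` ensures `|t - s| < ε`.
  have loc : ∀ (p₀ : P) (t₀ : ℝ), ∃ δ > 0, ∀ s ∈ Metric.ball t₀ δ, ContMDiffAt J I 1 (Γ s) p₀ →
      ∀ t ∈ Metric.ball t₀ δ, ContMDiffAt (𝓘(ℝ, ℝ).prod J) I 1 (fun z : ℝ × P ↦ Γ z.1 z.2) (t, p₀) := by
    intro p₀ t₀
    obtain ⟨W, hW, ε, hε, Φ, hΦ, hΦW⟩ := exists_contMDiffOn_localFlow hv (Γ t₀ p₀)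
    have hWi : ∀ᶠ s in 𝓝 t₀, W ∈ 𝓝 (Γ s p₀) :=
      (hΓ p₀).continuous.continuousAt.eventually (eventually_mem_nhds_iff.2 hW)
    obtain ⟨δ, hδ, hδW⟩ := Metric.eventually_nhds_iff_ball.1 hWi
    refine ⟨min δ (ε / 2), lt_min hδ (half_pos hε), fun s hs hQ t ht ↦ ?_⟩
    have hsW := hδW s (Metric.ball_subset_ball (min_le_left _ _) hs)
    have hst : t - s ∈ Ioo (-ε) ε := by
      have h1 := Metric.ball_subset_ball (min_le_right _ _) hs
      have h2 := Metric.ball_subset_ball (min_le_right _ _) ht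
      rw [Real.ball_eq_Ioo] at h1 h2
      constructor <;> linarith [h1.1, h1.2, h2.1, h2.2]
    have hcomp : ContMDiffAt (𝓘(ℝ, ℝ).prod J) I 1
        (fun z : ℝ × P ↦ Φ (Γ s z.2, z.1 - s)) (t, p₀) := by
      have hΦat : ContMDiffAt (I.prod 𝓘(ℝ, ℝ)) I 1 Φ (Γ s p₀, t - s) :=
        hΦ.contMDiffAt (prod_mem_nhds hsW (isOpen_Ioo.mem_nhds hst))
      refine ContMDiffAt.comp (t, p₀) (g := Φ) (f := fun z : ℝ × P ↦ (Γ s z.2, z.1 - s)) hΦat ?_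
      refine ContMDiffAt.prodMk (ContMDiffAt.comp (t, p₀) (g := Γ s) hQ contMDiffAt_snd) ?_
      have : ContMDiff 𝓘(ℝ, ℝ) 𝓘(ℝ, ℝ) 1 (fun x : ℝ ↦ x - s) :=
        (contDiff_id.sub contDiff_const).contMDiff
      exact ContMDiffAt.comp (I' := 𝓘(ℝ, ℝ)) (t, p₀) (g := fun x : ℝ ↦ x - s) (f := Prod.fst)
        this.contMDiffAt contMDiffAt_fst
    refine hcomp.congr_of_eventuallyEq ?_
    have e1 : ∀ᶠ p in 𝓝 p₀, Γ s p ∈ W := hQ.continuousAt.eventually_mem hsW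
    have e2 : ∀ᶠ x in 𝓝 t, x - s ∈ Ioo (-ε) ε :=
      (continuous_id.sub continuous_const).continuousAt.eventually_mem (isOpen_Ioo.mem_nhds hst)
    filter_upwards [e2.prod_nhds e1] with z hz
    have c1 : IsMIntegralCurveOn (fun x ↦ Γ (x + s) z.2) v (Ioo (-ε) ε) :=
      ((hΓ z.2).comp_add s).isMIntegralCurveOn _
    have := isMIntegralCurveOn_Ioo_eqOn_of_contMDiff_boundaryless (t₀ := 0) ⟨by linarith, hε⟩ hv c1
      (hΦW _ hz.2).2 (by simp [(hΦW _ hz.2).1]) hz.1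
    simpa using this
  have slice : ∀ (p₀ : P) (t : ℝ), ContMDiffAt (𝓘(ℝ, ℝ).prod J) I 1
      (fun z : ℝ × P ↦ Γ z.1 z.2) (t, p₀) → ContMDiffAt J I 1 (Γ t) p₀ := fun p₀ t h ↦
    ContMDiffAt.comp (g := fun z : ℝ × P ↦ Γ z.1 z.2) (f := fun p ↦ (t, p)) p₀ h
      (ContMDiffAt.prodMk (contMDiffAt_const (I := J) (M := P) (n := 1)) (contMDiffAt_id (I := J)))
  rintro ⟨t, p₀⟩
  -- The times at which `Γ t` is `C¹` at `p₀` form an open and closed subset of the line that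
  -- contains zero.
  have hclopen : IsClopen {t | ContMDiffAt J I 1 (Γ t) p₀} := by
    constructor
    · rw [← isOpen_compl_iff, Metric.isOpen_iff]
      intro t ht
      obtain ⟨δ, hδ, H⟩ := loc p₀ t
      exact ⟨δ, hδ, fun s hs hQ ↦ ht (slice _ _ (H s hs hQ t (Metric.mem_ball_self hδ)))⟩
    · rw [Metric.isOpen_iff]
      intro t ht
      obtain ⟨δ, hδ, H⟩ := loc p₀ t
      exact ⟨δ, hδ, fun s hs ↦ slice _ _ (H t (Metric.mem_ball_self hδ) ht s hs)⟩
  have huniv := hclopen.eq_univ ⟨0, h0 p₀⟩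
  obtain ⟨δ, hδ, H⟩ := loc p₀ t
  have ht : t ∈ {t | ContMDiffAt J I 1 (Γ t) p₀} := huniv ▸ mem_univ t
  exact H t (Metric.mem_ball_self hδ) ht t (Metric.mem_ball_self hδ)

end ManifoldFlow

/-! ### Multiplicity functions and functions with vanishing derivative -/

section Multiplicity

/-- Tonelli bounds the integral of the sum of norms, which also gives convergence almost everywhere.
It serves to assemble the multiplicity function from countably many injective pieces. -/
theorem integrable_tsum_of_summable_integral_norm {α : Type*} [MeasurableSpace α] {μ : Measure α}
    {F : ℕ → α → ℝ} (hF : ∀ n, Integrable (F n) μ) (hs : Summable fun n ↦ ∫ x, ‖F n x‖ ∂μ) :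
    Integrable (fun x ↦ ∑' n, F n x) μ := by
  have hfin : ∫⁻ x, ∑' n, ‖F n x‖ₑ ∂μ ≠ ⊤ := by
    rw [lintegral_tsum fun n ↦ (hF n).1.enorm]
    have : ∀ n, ∫⁻ x, ‖F n x‖ₑ ∂μ = ENNReal.ofReal (∫ x, ‖F n x‖ ∂μ) := fun n ↦
      (ofReal_integral_norm_eq_lintegral_enorm (hF n)).symm
    simp_rw [this]
    rw [← ENNReal.ofReal_tsum_of_nonneg (fun n ↦ integral_nonneg fun _ ↦ norm_nonneg _) hs]
    exact ENNReal.ofReal_ne_top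
  have hsum : ∀ᵐ x ∂μ, Summable fun n ↦ ‖F n x‖₊ := by
    filter_upwards [ae_lt_top' (AEMeasurable.tsum fun n ↦ (hF n).1.enorm) hfin] with x hx
    exact ENNReal.tsum_coe_ne_top_iff_summable.1 hx.ne
  refine ⟨aestronglyMeasurable_of_tendsto_ae atTop
    (f := fun k x ↦ ∑ n ∈ Finset.range k, F n x) (fun k ↦ ?_) ?_, ?_⟩
  · exact (integrable_finsetSum _ fun n _ ↦ hF n).1
  · filter_upwards [hsum] with x hx
    exact (Summable.of_nnnorm hx).hasSum.tendsto_sum_nat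
  · refine lt_of_le_of_lt (lintegral_mono_ae ?_) hfin.lt_top
    filter_upwards [hsum] with x hx
    have h1 := nnnorm_tsum_le hx
    have h2 : ((‖∑' n, F n x‖₊ : NNReal) : ENNReal) ≤ ((∑' n, ‖F n x‖₊ : NNReal) : ENNReal) :=
      ENNReal.coe_le_coe.2 h1
    rwa [ENNReal.coe_tsum hx] at h2

variable {E : Type*} [NormedAddCommGroup E] [NormedSpace ℝ E] [FiniteDimensional ℝ E]

/-- The regular points of a `C¹` map are covered by countably many open sets on which it is
injective and the Jacobian has a constant sign. -/
theorem exists_cover_injOn_det_sign {O : Set E} (hO : IsOpen O) {v : E → E}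
    (hv : ContDiffOn ℝ 1 v O) :
    ∃ (W : ℕ → Set E) (s : ℕ → ℤ), (∀ n, IsOpen (W n)) ∧ (∀ n, InjOn v (W n)) ∧
      (∀ n, ∀ p ∈ W n, (fderiv ℝ v p).det = s n * |(fderiv ℝ v p).det|) ∧ (∀ n, |s n| ≤ 1) ∧
      ⋃ n, W n = {p ∈ O | (fderiv ℝ v p).det ≠ 0} := by
  have hdet : ContinuousOn (fun p ↦ (fderiv ℝ v p).det) O :=
    ContinuousLinearMap.continuous_det.comp_continuousOn (hv.continuousOn_fderiv_of_isOpen hO le_rfl)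
  set R := {p ∈ O | (fderiv ℝ v p).det ≠ 0}
  have loc : ∀ p ∈ R, ∃ (W : Set E) (s : ℤ), IsOpen W ∧ p ∈ W ∧ InjOn v W ∧
      (∀ q ∈ W, (fderiv ℝ v q).det = s * |(fderiv ℝ v q).det|) ∧ |s| ≤ 1 ∧ W ⊆ R := by
    intro p hp
    have hst : HasStrictFDerivAt v
        (((fderiv ℝ v p).toContinuousLinearEquivOfDetNeZero hp.2 : E ≃L[ℝ] E) : E →L[ℝ] E) p := by
      rw [ContinuousLinearMap.coe_toContinuousLinearEquivOfDetNeZero]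
      exact (hv.contDiffAt (hO.mem_nhds hp.1)).hasStrictFDerivAt one_ne_zero
    set e := hst.toOpenPartialHomeomorph v
    have hinj : InjOn v e.source := e.injOn
    have hpe : p ∈ e.source := hst.mem_toOpenPartialHomeomorph_source
    rcases lt_or_gt_of_ne hp.2 with h | h
    · refine ⟨e.source ∩ (O ∩ (fun p ↦ (fderiv ℝ v p).det) ⁻¹' Iio 0), -1,
        e.open_source.inter (hdet.isOpen_inter_preimage hO isOpen_Iio), ⟨hpe, hp.1, h⟩,
        hinj.mono inter_subset_left, fun q hq ↦ ?_, by simp, fun q hq ↦ ⟨hq.2.1, ne_of_lt hq.2.2⟩⟩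
      rw [abs_of_neg hq.2.2]; simp
    · refine ⟨e.source ∩ (O ∩ (fun p ↦ (fderiv ℝ v p).det) ⁻¹' Ioi 0), 1,
        e.open_source.inter (hdet.isOpen_inter_preimage hO isOpen_Ioi), ⟨hpe, hp.1, h⟩,
        hinj.mono inter_subset_left, fun q hq ↦ ?_, by simp, fun q hq ↦ ⟨hq.2.1, ne_of_gt hq.2.2⟩⟩
      rw [abs_of_pos hq.2.2]; simp
  choose! W s hW hpW hinj hsgn hs hWR using loc
  -- The Lindelöf property leaves countably many inverse function neighbourhoods. Indices of the
  -- enumeration that are not regular points will carry the empty set.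
  obtain ⟨t, htR, htc, htU⟩ := TopologicalSpace.countable_cover_nhdsWithin (s := R) (f := W)
    fun p hp ↦ mem_nhdsWithin_of_mem_nhds ((hW p hp).mem_nhds (hpW p hp))
  obtain ⟨c, hc⟩ := countable_iff_exists_subset_range.1 htc
  classical
  refine ⟨fun n ↦ if c n ∈ R then W (c n) else ∅, fun n ↦ if c n ∈ R then s (c n) else 0,
    fun n ↦ ?_, fun n ↦ ?_, fun n p hp ↦ ?_, fun n ↦ ?_, ?_⟩
  · beta_reduce
    split_ifs with h
    exacts [hW _ h, isOpen_empty]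
  · beta_reduce
    split_ifs with h
    exacts [hinj _ h, injOn_empty _]
  · beta_reduce at hp ⊢
    split_ifs at hp ⊢ with h
    exacts [hsgn _ h p hp, hp.elim]
  · beta_reduce
    split_ifs with h
    exacts [hs _ h, by simp]
  · refine Subset.antisymm (iUnion_subset fun n ↦ ?_) fun p hp ↦ ?_
    · split_ifs with h
      exacts [hWR _ h, empty_subset _]
    · obtain ⟨q, hq, hpq⟩ := mem_iUnion₂.1 (htU hp)
      obtain ⟨n, rfl⟩ := hc hq
      exact mem_iUnion.2 ⟨n, by rwa [if_pos (htR hq)]⟩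

variable [MeasurableSpace E] [BorelSpace E] {μ : Measure E} [μ.IsAddHaarMeasure]

/-- The multiplicity function of a `C¹` map with integrable Jacobian: integrals of `g ∘ v` against
the signed Jacobian are integrals of `g` against an integer valued function. -/
theorem exists_multiplicity {O : Set E} (hO : IsOpen O) {v : E → E} (hv : ContDiffOn ℝ 1 v O)
    (hint : IntegrableOn (fun p ↦ (fderiv ℝ v p).det) O μ) :
    ∃ N : E → ℝ, Integrable N μ ∧ (∀ y, ∃ n : ℤ, N y = n) ∧
      ∀ g : E → ℝ, Measurable g → (∃ C, ∀ y, ‖g y‖ ≤ C) →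
        ∫ p in O, g (v p) * (fderiv ℝ v p).det ∂μ = ∫ y, g y * N y ∂μ := by
  obtain ⟨W, s, hW, hinj, hsgn, hs, hWR⟩ := exists_cover_injOn_det_sign hO hv
  set D := disjointed W with hD
  have hDW : ∀ n, D n ⊆ W n := disjointed_subset W
  have hDm : ∀ n, MeasurableSet (D n) := MeasurableSet.disjointed fun n ↦ (hW n).measurableSet
  have hDd : Pairwise (Function.onFun Disjoint D) := disjoint_disjointed W
  have hDU : ⋃ n, D n = {p ∈ O | (fderiv ℝ v p).det ≠ 0} := by rw [← hWR, iUnion_disjointed]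
  have hDO : ∀ n, D n ⊆ O := fun n p hp ↦ by
    have : p ∈ ⋃ n, D n := mem_iUnion.2 ⟨n, hp⟩
    rw [hDU] at this; exact this.1
  have hder : ∀ n, ∀ p ∈ D n, HasFDerivWithinAt v (fderiv ℝ v p) (D n) p := fun n p hp ↦
    ((hv.contDiffAt (hO.mem_nhds (hDO n hp))).differentiableAt one_ne_zero).hasFDerivAt.hasFDerivWithinAt
  have hDinj : ∀ n, InjOn v (D n) := fun n ↦ (hinj n).mono (hDW n)
  have him : ∀ n, MeasurableSet (v '' D n) := fun n ↦
    measurable_image_of_fderivWithin (hDm n) (hder n) (hDinj n)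
  have hdetint : ∀ n, IntegrableOn (fun p ↦ |(fderiv ℝ v p).det|) (D n) μ := fun n ↦
    (hint.mono_set (hDO n)).abs
  have hvol : ∀ n, IntegrableOn (fun _ ↦ (1 : ℝ)) (v '' D n) μ := fun n ↦
    (integrableOn_image_iff_integrableOn_abs_det_fderiv_smul μ (hDm n) (hder n) (hDinj n) _).2
      (by simpa using hdetint n)
  -- Summed over `n`, these count the regular preimages of a point, each with the sign of its
  -- Jacobian. By the area formula the `L¹` norm of `F n` is at most the integral of `|det|` over `D
  -- n`.
  set F : ℕ → E → ℝ := fun n ↦ (v '' D n).indicator fun _ ↦ (s n : ℝ) with hF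
  have hs' : ∀ n, ‖(s n : ℝ)‖ ≤ 1 := fun n ↦ by
    rw [Real.norm_eq_abs, ← Int.cast_abs]; exact_mod_cast hs n
  have hFint : ∀ n, Integrable (F n) μ := fun n ↦ by
    rw [hF, integrable_indicator_iff (him n)]
    refine ((hvol n).const_mul (s n : ℝ)).congr (Eventually.of_forall fun _ ↦ mul_one _)
  have hFle : ∀ n, ∫ y, ‖F n y‖ ∂μ ≤ ∫ p in D n, |(fderiv ℝ v p).det| ∂μ := fun n ↦ by
    have e : ∫ p in D n, |(fderiv ℝ v p).det| ∂μ = ∫ y in v '' D n, (1 : ℝ) ∂μ := by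
      rw [integral_image_eq_integral_abs_det_fderiv_smul μ (hDm n) (hder n) (hDinj n)]; simp
    rw [e, ← integral_indicator (him n)]
    refine integral_mono (hFint n).norm ((integrable_indicator_iff (him n)).2 (hvol n)) fun y ↦ ?_
    by_cases hy : y ∈ v '' D n <;> simp only [hF, indicator_of_mem, indicator_of_notMem, hy,
      not_false_eq_true, norm_zero, le_refl]
    exact hs' n
  have hsumdet := (hasSum_integral_iUnion hDm hDd
    ((hint.mono_set (by rw [hDU]; exact fun p hp ↦ hp.1)).abs)).summable
  have hFsum : Summable fun n ↦ ∫ y, ‖F n y‖ ∂μ :=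
    Summable.of_nonneg_of_le (fun n ↦ integral_nonneg fun _ ↦ norm_nonneg _) hFle hsumdet
  refine ⟨fun y ↦ ∑' n, F n y, integrable_tsum_of_summable_integral_norm hFint hFsum, fun y ↦ ?_,
    fun g hg hgb ↦ ?_⟩
  -- Partial sums are integers and the integers are closed in the line; where the series diverges,
  -- `tsum` takes the default value 0.
  · by_cases hsum : Summable fun n ↦ F n y
    · have hcl : IsClosed (range ((↑) : ℤ → ℝ)) := Int.isClosedEmbedding_coe_real.isClosed_range
      have hmem : ∀ k, ∑ n ∈ Finset.range k, F n y ∈ range ((↑) : ℤ → ℝ) := fun k ↦ by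
        refine ⟨∑ n ∈ Finset.range k, (v '' D n).indicator (fun _ ↦ s n) y, ?_⟩
        rw [Int.cast_sum]
        refine Finset.sum_congr rfl fun n _ ↦ ?_
        by_cases hy : y ∈ v '' D n <;> simp only [hF, indicator_of_mem, indicator_of_notMem, hy,
          not_false_eq_true, Int.cast_zero]
      obtain ⟨n, hn⟩ := hcl.mem_of_tendsto hsum.hasSum.tendsto_sum_nat (Eventually.of_forall hmem)
      exact ⟨n, hn.symm⟩
    · exact ⟨0, (tsum_eq_zero_of_not_summable hsum).trans Int.cast_zero.symm⟩
  · obtain ⟨C, hC⟩ := hgb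
    have hvm : AEStronglyMeasurable (fun p ↦ g (v p)) (μ.restrict O) :=
      (hg.comp_aemeasurable (hv.continuousOn.aemeasurable hO.measurableSet)).aestronglyMeasurable
    have hgint : IntegrableOn (fun p ↦ g (v p) * (fderiv ℝ v p).det) O μ :=
      hint.bdd_mul hvm (Eventually.of_forall fun p ↦ hC (v p))
    have hRsub : (⋃ n, D n) ⊆ O := iUnion_subset hDO
    -- Critical points contribute nothing, as the Jacobian vanishes there.
    have e1 : ∫ p in O, g (v p) * (fderiv ℝ v p).det ∂μ
        = ∫ p in ⋃ n, D n, g (v p) * (fderiv ℝ v p).det ∂μ := by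
      apply setIntegral_eq_of_subset_of_forall_sdiff_eq_zero hO.measurableSet hRsub
      intro p hp
      have : ¬ (fderiv ℝ v p).det ≠ 0 := fun h ↦ hp.2 (by rw [hDU]; exact ⟨hp.1, h⟩)
      rw [not_not.1 this, mul_zero]
    have e2 := (hasSum_integral_iUnion hDm hDd (hgint.mono_set hRsub)).tsum_eq
    have e3 : ∀ n, ∫ p in D n, g (v p) * (fderiv ℝ v p).det ∂μ = ∫ y, g y * F n y ∂μ := fun n ↦ by
      have : ∀ y, g y * F n y = (v '' D n).indicator (fun y ↦ g y * s n) y := fun y ↦ by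
        by_cases hy : y ∈ v '' D n <;> simp [hF, hy]
      simp_rw [this]
      rw [integral_indicator (him n),
        integral_image_eq_integral_abs_det_fderiv_smul μ (hDm n) (hder n) (hDinj n)]
      refine setIntegral_congr_fun (hDm n) fun p hp ↦ ?_
      simp only [smul_eq_mul]
      rw [hsgn n p (hDW n hp), abs_mul, abs_abs]
      rcases eq_or_ne ((fderiv ℝ v p).det) 0 with h | h
      · simp [h]
      · have h' := hsgn n p (hDW n hp)
        have : |(s n : ℝ)| = 1 := by
          have h2 := congrArg abs h'
          rw [abs_mul, abs_abs] at h2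
          exact (mul_eq_right₀ (abs_ne_zero.2 h)).1 h2.symm
        rw [this]; ring
    have hgF : ∀ n, Integrable (fun y ↦ g y * F n y) μ := fun n ↦
      (hFint n).bdd_mul hg.aestronglyMeasurable (Eventually.of_forall hC)
    have hgFs : Summable fun n ↦ ∫ y, ‖g y * F n y‖ ∂μ := by
      refine Summable.of_nonneg_of_le (fun n ↦ integral_nonneg fun _ ↦ norm_nonneg _) (fun n ↦ ?_)
        (hFsum.mul_left C)
      rw [← integral_const_mul]
      refine integral_mono (hgF n).norm ((hFint n).norm.const_mul C) fun y ↦ ?_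
      simp only [norm_mul]
      exact mul_le_mul_of_nonneg_right (hC y) (norm_nonneg _)
    rw [e1, ← e2]
    simp_rw [e3, ← tsum_mul_left]
    exact (hasSum_integral_of_summable_integral_norm hgF hgFs).tsum_eq

/-- A function whose distributional derivative vanishes on a ball is almost everywhere constant on
the concentric ball of half the radius. -/
theorem ae_eq_const_of_integral_fderiv_mul_eq_zero {N : E → ℝ} (hN : LocallyIntegrable N μ)
    {y₀ : E} {R : ℝ} (hR : 0 < R)
    (h : ∀ f : E → ℝ, ContDiff ℝ ∞ f → HasCompactSupport f → tsupport f ⊆ Metric.ball y₀ (2 * R) →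
      ∀ w, ∫ y, fderiv ℝ f y w * N y ∂μ = 0) :
    ∃ y₁, ∀ᵐ y ∂μ, y ∈ Metric.ball y₀ R → N y = N y₁ := by
  -- The ratio 2 of the radii lets the mollified functions converge almost everywhere. Radii at most
  -- `R / 2` keep a bump centred in the `R`-ball inside the `2R`-ball.
  set φ : ℕ → ContDiffBump (0 : E) := fun n ↦
    ⟨R / (n + 1) / 4, R / (n + 1) / 2, by positivity, by
      have : 0 < R / ((n : ℝ) + 1) := by positivity
      linarith⟩ with hφ
  have hout : Tendsto (fun n ↦ (φ n).rOut) atTop (𝓝 0) := by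
    have := (tendsto_one_div_add_atTop_nhds_zero_nat (𝕜 := ℝ)).const_mul (R / 2)
    simp only [mul_zero] at this
    refine this.congr fun n ↦ ?_
    simp only [hφ]; ring
  have hlim := ContDiffBump.ae_convolution_tendsto_right_of_locallyIntegrable (μ := μ) (φ := φ)
    (l := atTop) (K := 2) hout (Eventually.of_forall fun n ↦ by simp only [hφ]; linarith) hN
  set c : ℕ → E → ℝ := fun n ↦
    convolution ((φ n).normed μ) N (ContinuousLinearMap.lsmul ℝ ℝ) μ with hc
  -- The derivative of the mollified function at `z` is, up to sign, `N` tested against the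
  -- derivative of `y ↦ φ (z - y)`, which the hypothesis makes zero.
  have hconst : ∀ n, ∀ x ∈ Metric.ball y₀ R, c n x = c n y₀ := by
    intro n x hx
    have hcs : HasCompactSupport ((φ n).normed μ) := (φ n).hasCompactSupport_normed
    have hsm : ContDiff ℝ ∞ ((φ n).normed μ) := (φ n).contDiff_normed
    have hd : ∀ x, HasFDerivAt (c n) _ x := fun x ↦
      hcs.hasFDerivAt_convolution_left (ContinuousLinearMap.lsmul ℝ ℝ) (hsm.of_le (by norm_cast)) hN x
    refine (convex_ball y₀ R).is_const_of_fderivWithin_eq_zero (𝕜 := ℝ)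
      (fun z _ ↦ (hd z).differentiableAt.differentiableWithinAt) (fun z hz ↦ ?_) hx
      (Metric.mem_ball_self hR)
    rw [fderivWithin_of_isOpen Metric.isOpen_ball hz, (hd z).fderiv]
    ext w
    have hex := (hcs.fderiv (𝕜 := ℝ)).convolutionExists_left
      ((ContinuousLinearMap.lsmul ℝ ℝ : ℝ →L[ℝ] ℝ →L[ℝ] ℝ).precompL E)
      (hsm.continuous_fderiv (by simp)) hN z
    rw [convolution_def, ContinuousLinearMap.integral_apply hex]
    have := h (fun y ↦ (φ n).normed μ (z - y)) (hsm.comp (contDiff_const.sub contDiff_id))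
      (hcs.comp_homeomorph (Homeomorph.subLeft z)) ?_ w
    · have e : ∀ y, fderiv ℝ (fun y ↦ (φ n).normed μ (z - y)) y w
          = -fderiv ℝ ((φ n).normed μ) (z - y) w := fun y ↦ by
        have h1 := ((hsm.differentiable (by simp) (z - y)).hasFDerivAt).comp y
          ((hasFDerivAt_id y).const_sub z)
        have h2 : fderiv ℝ (fun y ↦ (φ n).normed μ (z - y)) y = _ := h1.fderiv
        rw [h2]; simp
      simp_rw [e] at this
      rw [← integral_sub_left_eq_self _ μ z]
      simp only [neg_mul, integral_neg, neg_eq_zero] at this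
      simpa [ContinuousLinearMap.precompL_apply] using this
    · refine (closure_minimal ?_ Metric.isClosed_closedBall).trans
        (?_ : Metric.closedBall z ((φ n).rOut) ⊆ _)
      · intro y hy
        have hy' : z - y ∈ Function.support ((φ n).normed μ) := hy
        rw [(φ n).support_normed_eq] at hy'
        rw [Metric.mem_closedBall, dist_comm, dist_eq_norm]
        exact (by simpa using hy' : ‖z - y‖ < _).le
      · refine Metric.closedBall_subset_ball' ?_
        have h1 : (φ n).rOut ≤ R / 2 := by
          simp only [hφ]
          gcongr
          exact div_le_self hR.le (by linarith [(n.cast_nonneg : (0 : ℝ) ≤ n)])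
        have := Metric.mem_ball.1 hz
        linarith
  have hpos : 0 < μ (Metric.ball y₀ R) := Metric.measure_ball_pos μ _ hR
  -- The ball has positive measure, so it contains a point of convergence, whose limit is the
  -- required constant.
  obtain ⟨y₁, hy₁, hl₁⟩ : ∃ y₁ ∈ Metric.ball y₀ R, Tendsto (fun n ↦ c n y₁) atTop (𝓝 (N y₁)) := by
    by_contra hcon
    push Not at hcon
    exact hpos.ne' (measure_mono_null (fun y hy ↦ hcon y hy) (ae_iff.1 hlim))
  refine ⟨y₁, ?_⟩
  filter_upwards [hlim] with y hy hyR
  refine tendsto_nhds_unique hy (hl₁.congr fun n ↦ ?_)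
  change c n y₁ = c n y
  rw [hconst n y hyR, hconst n y₁ hy₁]

end Multiplicity

/-! ### Charts with values in `ℝ × ℝ` and pullbacks of the area form -/

section Coordinates

theorem det_prod_eq (L : ℝ × ℝ →L[ℝ] ℝ × ℝ) :
    L.det = (L (1, 0)).1 * (L (0, 1)).2 - (L (0, 1)).1 * (L (1, 0)).2 := by
  rw [ContinuousLinearMap.det, ← LinearMap.det_toMatrix (Module.Basis.finTwoProd ℝ),
    Matrix.det_fin_two]
  simp [LinearMap.toMatrix_apply]

/-- An alternating bilinear form on the image of the plane scales by the determinant. -/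
theorem alternating_apply_eq_det_mul {V : Type*} [NormedAddCommGroup V] [NormedSpace ℝ V]
    (B : V →L[ℝ] V →L[ℝ] ℝ) (hB : ∀ v, B v v = 0) (A : ℝ × ℝ →L[ℝ] V)
    (L : ℝ × ℝ →L[ℝ] ℝ × ℝ) :
    B (A (L (1, 0))) (A (L (0, 1))) = B (A (1, 0)) (A (0, 1)) * L.det := by
  have hdec : ∀ z : ℝ × ℝ, A z = z.1 • A (1, 0) + z.2 • A (0, 1) := fun z ↦ by
    rw [← map_smul, ← map_smul, ← map_add]; simp
  have hsw : ∀ v w, B v w = -B w v := fun v w ↦ by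
    have := hB (v + w)
    simp only [map_add, add_apply, hB] at this
    linarith
  rw [hdec (L (1, 0)), hdec (L (0, 1)), det_prod_eq]
  simp only [map_add, map_smul, add_apply, smul_apply, smul_eq_mul, hB]
  rw [hsw (A (0, 1)) (A (1, 0))]
  ring

/-- The identification of the model plane with `ℝ × ℝ`. -/
def planeEquiv : Plane ≃L[ℝ] ℝ × ℝ :=
  (EuclideanSpace.equiv (Fin 2) ℝ).trans (ContinuousLinearEquiv.finTwoArrow ℝ ℝ)

theorem measurePreserving_planeEquiv : MeasurePreserving planeEquiv :=
  (volume_preserving_finTwoArrow ℝ).comp (PiLp.volume_preserving_ofLp (Fin 2))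

theorem planeEquiv_symm_fst : planeEquiv.symm (1, 0) = EuclideanSpace.single 0 (1 : ℝ) := by
  rw [ContinuousLinearEquiv.symm_apply_eq]
  simp [planeEquiv]

theorem planeEquiv_symm_snd : planeEquiv.symm (0, 1) = EuclideanSpace.single 1 (1 : ℝ) := by
  rw [ContinuousLinearEquiv.symm_apply_eq]
  simp [planeEquiv]

/-- The tangent map of a `C^(n+1)` map is `C^n`; here it is composed with the section `w`. -/
theorem contMDiffOn_mfderivWithin_apply {E F H N : Type*} [NormedAddCommGroup E] [NormedSpace ℝ E]
    [NormedAddCommGroup F] [NormedSpace ℝ F] [TopologicalSpace H] {I : ModelWithCorners ℝ F H}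
    [TopologicalSpace N] [ChartedSpace H N] {n : WithTop ℕ∞} [IsManifold I (n + 1) N]
    {q : E → N} {s : Set E} (hq : ContMDiffOn 𝓘(ℝ, E) I (n + 1) q s) (hs : UniqueDiffOn ℝ s)
    {w : E → E} (hw : ContDiffOn ℝ n w s) :
    haveI : IsManifold I 1 N := IsManifold.of_le (n := n + 1) (self_le_add_left 1 n)
    ContMDiffOn 𝓘(ℝ, E) I.tangent n
      (fun p ↦ (⟨q p, mfderivWithin 𝓘(ℝ, E) I q s p (w p)⟩ : TangentBundle I N)) s := by
  have : IsManifold I 1 N := IsManifold.of_le (n := n + 1) (self_le_add_left 1 n)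
  have h1 : ContMDiffOn 𝓘(ℝ, E) 𝓘(ℝ, E).tangent n
      (fun p ↦ (⟨p, w p⟩ : TangentBundle 𝓘(ℝ, E) E)) s := fun p hp ↦
    contMDiffWithinAt_vectorSpace_iff_contDiffWithinAt.2 (hw p hp)
  exact (hq.contMDiffOn_tangentMapWithin le_rfl hs.uniqueMDiffOn).comp h1 fun p hp ↦ hp

variable {M : Type*} [TopologicalSpace M] [ChartedSpace Plane M]

/-- The preferred chart at `x`, with values in `ℝ × ℝ`. -/
def coord (x : M) (m : M) : ℝ × ℝ := planeEquiv (extChartAt (𝓡 2) x m)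

/-- The inverse of the preferred chart at `x`. -/
def coordInv (x : M) (u : ℝ × ℝ) : M := (extChartAt (𝓡 2) x).symm (planeEquiv.symm u)

/-- The domain of the preferred chart at `x`. -/
def coordSource (x : M) : Set M := (extChartAt (𝓡 2) x).source

/-- The range of the preferred chart at `x`. -/
def coordTarget (x : M) : Set (ℝ × ℝ) := planeEquiv.symm ⁻¹' (extChartAt (𝓡 2) x).target

theorem coordInv_coord {x m : M} (h : m ∈ coordSource x) : coordInv x (coord x m) = m := by
  simp only [coordInv, coord, ContinuousLinearEquiv.symm_apply_apply]
  exact (extChartAt (𝓡 2) x).left_inv h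

theorem coord_coordInv {x : M} {u : ℝ × ℝ} (h : u ∈ coordTarget x) : coord x (coordInv x u) = u := by
  simp only [coordInv, coord, (extChartAt (𝓡 2) x).right_inv h,
    ContinuousLinearEquiv.apply_symm_apply]

theorem coord_mem_coordTarget {x m : M} (h : m ∈ coordSource x) : coord x m ∈ coordTarget x := by
  simp only [coordTarget, coord, mem_preimage, ContinuousLinearEquiv.symm_apply_apply]
  exact (extChartAt (𝓡 2) x).map_source h

theorem coordInv_mem_coordSource {x : M} {u : ℝ × ℝ} (h : u ∈ coordTarget x) :
    coordInv x u ∈ coordSource x :=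
  (extChartAt (𝓡 2) x).map_target h

theorem mem_coordSource (x : M) : x ∈ coordSource x := mem_extChartAt_source x

theorem isOpen_coordSource (x : M) : IsOpen (coordSource x) := isOpen_extChartAt_source x

theorem isOpen_coordTarget (x : M) : IsOpen (coordTarget x) :=
  (isOpen_extChartAt_target x).preimage planeEquiv.symm.continuous

theorem coord_image_eq {x : M} {S : Set M} (hS : S ⊆ coordSource x) :
    coord x '' S = coordTarget x ∩ coordInv x ⁻¹' S := by
  ext u
  constructor
  · rintro ⟨m, hm, rfl⟩
    exact ⟨coord_mem_coordTarget (hS hm), by rwa [mem_preimage, coordInv_coord (hS hm)]⟩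
  · rintro ⟨hu, huS⟩
    exact ⟨coordInv x u, huS, coord_coordInv hu⟩

variable [IsManifold (𝓡 2) ∞ M]

theorem contMDiffOn_coord (x : M) : ContMDiffOn (𝓡 2) 𝓘(ℝ, ℝ × ℝ) ∞ (coord x) (coordSource x) := by
  have h : ContMDiffOn (𝓡 2) 𝓘(ℝ, Plane) ∞ (extChartAt (𝓡 2) x) (coordSource x) := by
    simpa [coordSource] using contMDiffOn_extChartAt (I := 𝓡 2) (x := x) (n := ∞)
  exact (planeEquiv.contDiff.contMDiff.contMDiffOn (s := univ)).comp h (fun _ _ ↦ mem_univ _)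

theorem contMDiffOn_coordInv (x : M) :
    ContMDiffOn 𝓘(ℝ, ℝ × ℝ) (𝓡 2) ∞ (coordInv x) (coordTarget x) :=
  (contMDiffOn_extChartAt_symm x).comp planeEquiv.symm.contDiff.contMDiff.contMDiffOn
    fun _ h ↦ h

theorem continuousOn_coord (x : M) : ContinuousOn (coord x) (coordSource x) :=
  (contMDiffOn_coord x).continuousOn

theorem continuousOn_coordInv (x : M) : ContinuousOn (coordInv x) (coordTarget x) :=
  (contMDiffOn_coordInv x).continuousOn

theorem mdifferentiableAt_coord {x m : M} (h : m ∈ coordSource x) :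
    MDifferentiableAt (𝓡 2) 𝓘(ℝ, ℝ × ℝ) (coord x) m :=
  ((contMDiffOn_coord x).contMDiffAt ((isOpen_coordSource x).mem_nhds h)).mdifferentiableAt
    (by simp)

theorem mdifferentiableAt_coordInv {x : M} {u : ℝ × ℝ} (h : u ∈ coordTarget x) :
    MDifferentiableAt 𝓘(ℝ, ℝ × ℝ) (𝓡 2) (coordInv x) u :=
  ((contMDiffOn_coordInv x).contMDiffAt ((isOpen_coordTarget x).mem_nhds h)).mdifferentiableAt
    (by simp)

/-- The area form at `m` as a bilinear form on the model plane. -/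
def areaAt (Ω : AreaForm M) (m : M) : Plane →L[ℝ] Plane →L[ℝ] ℝ := Ω.toFun m

/-- The derivative of a map between a normed space and `M`, with values in the model plane. -/
def tderWithin {E : Type*} [NormedAddCommGroup E] [NormedSpace ℝ E] (q : E → M) (s : Set E) (p : E) :
    E →L[ℝ] Plane := mfderivWithin 𝓘(ℝ, E) (𝓡 2) q s p

/-- The derivative of a map between a normed space and `M`, with values in the model plane. -/
def tder {E : Type*} [NormedAddCommGroup E] [NormedSpace ℝ E] (q : E → M) (p : E) :
    E →L[ℝ] Plane := mfderiv 𝓘(ℝ, E) (𝓡 2) q p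

/-- The derivative of the preferred chart at `x`. -/
def coordDer (x m : M) : Plane →L[ℝ] ℝ × ℝ := mfderiv (𝓡 2) 𝓘(ℝ, ℝ × ℝ) (coord x) m

/-- The density with respect to `ds dt` of the pullback of the area form under a map `q` from the
subset `s` of the plane to `M`. -/
def pullDensityWithin (Ω : AreaForm M) (q : ℝ × ℝ → M) (s : Set (ℝ × ℝ)) (p : ℝ × ℝ) : ℝ :=
  areaAt Ω (q p) (tderWithin q s p (1, 0)) (tderWithin q s p (0, 1))

/-- The density of the pullback of the area form under a map `q` from the plane to `M`. -/
def pullDensity (Ω : AreaForm M) (q : ℝ × ℝ → M) (p : ℝ × ℝ) : ℝ :=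
  areaAt Ω (q p) (tder q p (1, 0)) (tder q p (0, 1))

theorem pullDensityWithin_of_mem_nhds {Ω : AreaForm M} {q : ℝ × ℝ → M} {s : Set (ℝ × ℝ)}
    {p : ℝ × ℝ} (h : s ∈ 𝓝 p) : pullDensityWithin Ω q s p = pullDensity Ω q p := by
  rw [pullDensityWithin, pullDensity, tderWithin, tder, mfderivWithin_of_mem_nhds h]

/-- The density is `Ω` contracted with two vector fields along `q`, each one class less regular than
`q`. It is used with `n = 0` on the closed square and with `n = ∞` in charts. -/
theorem contDiffOn_pullDensityWithin (Ω : AreaForm M) {q : ℝ × ℝ → M} {s : Set (ℝ × ℝ)}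
    {n : WithTop ℕ∞} (hn : n + 1 ≤ ∞) (hq : ContMDiffOn 𝓘(ℝ, ℝ × ℝ) (𝓡 2) (n + 1) q s)
    (hs : UniqueDiffOn ℝ s) : ContDiffOn ℝ n (pullDensityWithin Ω q s) s := by
  have : IsManifold (𝓡 2) (n + 1) M := IsManifold.of_le hn
  have hn' : n ≤ ∞ := le_self_add.trans hn
  have hΩ := (Ω.contMDiff.of_le hn').comp_contMDiffOn (hq.of_le le_self_add)
  have h1 := contMDiffOn_mfderivWithin_apply hq hs (w := fun _ ↦ (1, 0)) contDiffOn_const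
  have h2 := contMDiffOn_mfderivWithin_apply hq hs (w := fun _ ↦ (0, 1)) contDiffOn_const
  intro p hp
  have := ContMDiffWithinAt.clm_bundle_apply₂ (F₁ := Plane) (F₂ := Plane) (F₃ := ℝ)
    (E₁ := fun x : M ↦ TangentSpace (𝓡 2) x) (E₂ := fun x : M ↦ TangentSpace (𝓡 2) x)
    (E₃ := fun _ ↦ ℝ) (b := q)
    (ψ := fun p ↦ Ω.toFun (q p)) (hΩ p hp) (h1 p hp) (h2 p hp)
  simp only [Bundle.contMDiffWithinAt_totalSpace] at this
  exact this.2.contDiffWithinAt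

end Coordinates

/-! ### The area measure in coordinates -/

section AreaMeasure

variable {M : Type*} [TopologicalSpace M] [ChartedSpace Plane M] [IsManifold (𝓡 2) ∞ M]

/-- The area density in the coordinates of the preferred chart at `x`, with sign. -/
abbrev chartDensity (Ω : AreaForm M) (x : M) (u : ℝ × ℝ) : ℝ := pullDensity Ω (coordInv x) u

/-- Near `p` the map is `coordInv x` after its coordinate expression, and an alternating form on a
plane scales by the determinant. This reduces areas of squares, and changes of chart, to Jacobians
in the plane. -/
theorem pullDensity_eq_chartDensity_mul_det (Ω : AreaForm M) {q : ℝ × ℝ → M} {p : ℝ × ℝ} {x : M}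
    (hq : MDifferentiableAt 𝓘(ℝ, ℝ × ℝ) (𝓡 2) q p) (hp : q p ∈ coordSource x) :
    pullDensity Ω q p
      = chartDensity Ω x (coord x (q p)) * (fderiv ℝ (fun p ↦ coord x (q p)) p).det := by
  set v : ℝ × ℝ → ℝ × ℝ := fun p ↦ coord x (q p) with hv
  have hvd : MDifferentiableAt 𝓘(ℝ, ℝ × ℝ) 𝓘(ℝ, ℝ × ℝ) v p := (mdifferentiableAt_coord hp).comp p hq
  have hqv : q =ᶠ[𝓝 p] coordInv x ∘ v := by
    filter_upwards [hq.continuousAt.eventually_mem ((isOpen_coordSource x).mem_nhds hp)] with z hz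
    exact (coordInv_coord hz).symm
  have hchain : tder q p = (tder (coordInv x) (v p)).comp (fderiv ℝ v p) := by
    have hinv : MDifferentiableAt 𝓘(ℝ, ℝ × ℝ) (𝓡 2) (coordInv x) (v p) :=
      mdifferentiableAt_coordInv (coord_mem_coordTarget hp)
    have := mfderiv_comp (I := 𝓘(ℝ, ℝ × ℝ)) (I' := 𝓘(ℝ, ℝ × ℝ)) (I'' := 𝓡 2) p hinv hvd
    rw [← hqv.mfderiv_eq, mfderiv_eq_fderiv] at this
    exact this
  have hinv : coordInv x (v p) = q p := coordInv_coord hp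
  rw [pullDensity, hchain, chartDensity, pullDensity, hinv]
  exact alternating_apply_eq_det_mul (areaAt Ω (q p)) (Ω.alternating (q p)) _ _

theorem coordDer_tder_coordInv {x : M} {u : ℝ × ℝ} (hu : u ∈ coordTarget x) (z : ℝ × ℝ) :
    coordDer x (coordInv x u) (tder (coordInv x) u z) = z := by
  have h1 := mfderiv_comp u (mdifferentiableAt_coord (coordInv_mem_coordSource hu))
    (mdifferentiableAt_coordInv hu)
  have h2 : coord x ∘ coordInv x =ᶠ[𝓝 u] id := by
    filter_upwards [(isOpen_coordTarget x).mem_nhds hu] with w hw using coord_coordInv hw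
  rw [h2.mfderiv_eq, mfderiv_id] at h1
  exact (DFunLike.congr_fun h1 z).symm

theorem tder_coordInv_coordDer {x m : M} (hm : m ∈ coordSource x) (w : Plane) :
    tder (coordInv x) (coord x m) (coordDer x m w) = w := by
  have h1 := mfderiv_comp m (mdifferentiableAt_coordInv (coord_mem_coordTarget hm))
    (mdifferentiableAt_coord hm)
  have h2 : coordInv x ∘ coord x =ᶠ[𝓝 m] id := by
    filter_upwards [(isOpen_coordSource x).mem_nhds hm] with w hw using coordInv_coord hw
  rw [h2.mfderiv_eq, mfderiv_id] at h1
  exact (DFunLike.congr_fun h1 w).symm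

/-- If the density vanished, the first coordinate vector would be `Ω`-orthogonal to both coordinate
vectors, hence to the tangent plane, against nondegeneracy. -/
theorem chartDensity_ne_zero (Ω : AreaForm M) {x : M} {u : ℝ × ℝ} (hu : u ∈ coordTarget x) :
    chartDensity Ω x u ≠ 0 := by
  intro h
  rw [chartDensity, pullDensity] at h
  set A : ℝ × ℝ →L[ℝ] Plane := tder (coordInv x) u with hA
  have hsurj : ∀ w, ∃ z, A z = w := fun w ↦ by
    have := tder_coordInv_coordDer (coordInv_mem_coordSource hu) w
    rw [coord_coordInv hu] at this
    exact ⟨_, this⟩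
  have hzero : A (1, 0) = 0 := by
    refine Ω.nondegenerate (coordInv x u) (A (1, 0)) fun w ↦ ?_
    obtain ⟨z, rfl⟩ := hsurj w
    have hdec : A z = z.1 • A (1, 0) + z.2 • A (0, 1) := by
      rw [← map_smul, ← map_smul, ← map_add]; simp
    change areaAt Ω (coordInv x u) (A (1, 0)) (A z) = 0
    have h0 : areaAt Ω (coordInv x u) (A (1, 0)) (A (1, 0)) = 0 :=
      Ω.alternating (coordInv x u) (A (1, 0))
    rw [hdec, map_add, map_smul, map_smul, h, h0]
    simp
  have := coordDer_tder_coordInv hu (1, 0)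
  rw [← hA, hzero, map_zero] at this
  simpa using congrArg Prod.fst this

theorem contDiffOn_chartDensity (Ω : AreaForm M) (x : M) :
    ContDiffOn ℝ ∞ (chartDensity Ω x) (coordTarget x) := by
  refine (contDiffOn_pullDensityWithin Ω (n := ∞) (by simp) ((contMDiffOn_coordInv x).of_le (by simp))
    (isOpen_coordTarget x).uniqueDiffOn).congr fun u hu ↦ ?_
  exact (pullDensityWithin_of_mem_nhds ((isOpen_coordTarget x).mem_nhds hu)).symm

theorem areaDensity_eq (Ω : AreaForm M) {x : M} {w : Plane}
    (hw : w ∈ (extChartAt (𝓡 2) x).target) :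
    areaDensity Ω x w = |chartDensity Ω x (planeEquiv w)| := by
  have hu : planeEquiv w ∈ coordTarget x := by simpa [coordTarget] using hw
  have hs : MDifferentiableAt 𝓘(ℝ, Plane) (𝓡 2) (extChartAt (𝓡 2) x).symm w :=
    ((contMDiffOn_extChartAt_symm (n := ∞) x).contMDiffAt
      ((isOpen_extChartAt_target x).mem_nhds hw)).mdifferentiableAt (by simp)
  have hchain : tder (coordInv x) (planeEquiv w) =
      (tder (extChartAt (𝓡 2) x).symm w).comp (planeEquiv.symm : ℝ × ℝ →L[ℝ] Plane) := by
    have h1 : MDifferentiableAt 𝓘(ℝ, ℝ × ℝ) 𝓘(ℝ, Plane) planeEquiv.symm (planeEquiv w) :=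
      planeEquiv.symm.differentiable.differentiableAt.mdifferentiableAt
    have h2 := mfderiv_comp (I := 𝓘(ℝ, ℝ × ℝ)) (I' := 𝓘(ℝ, Plane)) (I'' := 𝓡 2)
      (g := (extChartAt (𝓡 2) x).symm) (f := planeEquiv.symm)
      (planeEquiv w) (by rwa [ContinuousLinearEquiv.symm_apply_apply]) h1
    rw [ContinuousLinearEquiv.symm_apply_apply, mfderiv_eq_fderiv,
      ContinuousLinearEquiv.fderiv] at h2
    exact h2
  rw [chartDensity, pullDensity, hchain]
  simp only [coordInv, ContinuousLinearEquiv.symm_apply_apply, ContinuousLinearMap.comp_apply,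
    ContinuousLinearEquiv.coe_coe, planeEquiv_symm_fst, planeEquiv_symm_snd]
  rfl

variable [MeasurableSpace M] [BorelSpace M]

theorem measurableSet_coordTarget_inter (x : M) {S : Set M} (hS : MeasurableSet S) :
    MeasurableSet (coordTarget x ∩ coordInv x ⁻¹' S) := by
  have h : Measurable ((coordTarget x).domRestrict (coordInv x)) :=
    (continuousOn_iff_continuous_domRestrict.1 (continuousOn_coordInv x)).measurable
  have := ((isOpen_coordTarget x).measurableSet).subtype_image (h hS)
  convert this using 1
  ext u
  constructor
  · rintro ⟨hu, huS⟩
    exact ⟨⟨u, hu⟩, huS, rfl⟩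
  · rintro ⟨⟨w, hw⟩, hwS, rfl⟩
    exact ⟨hw, hwS⟩

theorem chartArea_apply (Ω : AreaForm M) (x : M) {S : Set M} (hS : MeasurableSet S) :
    chartArea Ω x S = ∫⁻ u in coordTarget x ∩ coordInv x ⁻¹' S,
      ENNReal.ofReal |chartDensity Ω x u| := by
  have hT : MeasurableSet (extChartAt (𝓡 2) x).target := (isOpen_extChartAt_target x).measurableSet
  have hae : AEMeasurable (extChartAt (𝓡 2) x).symm
      (((volume : Measure Plane).restrict (extChartAt (𝓡 2) x).target).withDensity
        (fun u ↦ ENNReal.ofReal (areaDensity Ω x u))) :=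
    ((continuousOn_extChartAt_symm x).aemeasurable hT).mono_ac (withDensity_absolutelyContinuous _ _)
  rw [chartArea, Measure.map_apply_of_aemeasurable hae hS, withDensity_apply', 
    Measure.restrict_restrict' hT,
    ← measurePreserving_planeEquiv.setLIntegral_comp_preimage_emb
      planeEquiv.toHomeomorph.measurableEmbedding]
  have hset : planeEquiv ⁻¹' (coordTarget x ∩ coordInv x ⁻¹' S)
      = (extChartAt (𝓡 2) x).symm ⁻¹' S ∩ (extChartAt (𝓡 2) x).target := by
    ext w; simp [coordTarget, coordInv, and_comm]
  have hm : MeasurableSet ((extChartAt (𝓡 2) x).symm ⁻¹' S ∩ (extChartAt (𝓡 2) x).target) := by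
    rw [← hset]
    exact planeEquiv.continuous.measurable (measurableSet_coordTarget_inter x hS)
  rw [hset]
  exact setLIntegral_congr_fun hm fun w hw ↦ by simp only [areaDensity_eq Ω hw.2]

/-- Change of variables under the transition map, whose Jacobian is the ratio of the two densities.
-/
theorem chartArea_eq_of_subset (Ω : AreaForm M) {x y : M} {S : Set M} (hS : MeasurableSet S)
    (hx : S ⊆ coordSource x) (hy : S ⊆ coordSource y) : chartArea Ω x S = chartArea Ω y S := by
  set T : ℝ × ℝ → ℝ × ℝ := fun u ↦ coord y (coordInv x u) with hT
  have hSx := coord_image_eq hx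
  have hSm : MeasurableSet (coord x '' S) := by
    rw [hSx]; exact measurableSet_coordTarget_inter x hS
  have him : coord y '' S = T '' (coord x '' S) := by
    rw [image_image]
    refine image_congr fun m hm ↦ ?_
    simp only [hT, coordInv_coord (hx hm)]
  have hmem : ∀ u ∈ coord x '' S, u ∈ coordTarget x ∧ coordInv x u ∈ S := fun u hu ↦ by
    rw [hSx] at hu; exact hu
  have hd : ∀ u ∈ coord x '' S, HasFDerivWithinAt T (fderiv ℝ T u) (coord x '' S) u := by
    intro u hu
    obtain ⟨h1, h2⟩ := hmem u hu
    have : MDifferentiableAt 𝓘(ℝ, ℝ × ℝ) 𝓘(ℝ, ℝ × ℝ) T u :=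
      (mdifferentiableAt_coord (hy h2)).comp u (mdifferentiableAt_coordInv h1)
    exact this.differentiableAt.hasFDerivAt.hasFDerivWithinAt
  have hinj : InjOn T (coord x '' S) := by
    rintro _ ⟨m, hm, rfl⟩ _ ⟨m', hm', rfl⟩ h
    simp only [hT, coordInv_coord (hx hm), coordInv_coord (hx hm')] at h
    rw [← coordInv_coord (hy hm), ← coordInv_coord (hy hm'), h]
  rw [chartArea_apply Ω x hS, chartArea_apply Ω y hS, ← coord_image_eq hx, ← coord_image_eq hy, him,
    lintegral_image_eq_lintegral_abs_det_fderiv_mul volume hSm hd hinj]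
  refine setLIntegral_congr_fun hSm fun u hu ↦ ?_
  obtain ⟨h1, h2⟩ := hmem u hu
  rw [← ENNReal.ofReal_mul (abs_nonneg _), ← abs_mul, chartDensity,
    pullDensity_eq_chartDensity_mul_det Ω (mdifferentiableAt_coordInv h1) (hy h2), mul_comm]

/-- A supremum of measures is not computed set by set, so the upper bound comes from a majorant:
`chartArea Ω x` plus infinite mass at every point outside the chart at `x`. Sets that leave the
chart then need no estimate, and on the others the chart areas are compatible. -/
theorem areaMeasure_apply_of_subset (Ω : AreaForm M) {x : M} {S : Set M} (hS : MeasurableSet S)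
    (hx : S ⊆ coordSource x) : areaMeasure Ω S = chartArea Ω x S := by
  refine le_antisymm ?_ (Measure.le_iff'.1 (le_iSup (fun x ↦ chartArea Ω x) x) S)
  set ν : Measure M := chartArea Ω x + (⊤ : ENNReal) • (Measure.count.restrict (coordSource x)ᶜ)
  have hxm : MeasurableSet (coordSource x) := (isOpen_coordSource x).measurableSet
  have hle : areaMeasure Ω ≤ ν := by
    refine iSup_le fun y ↦ Measure.le_iff.2 fun A hA ↦ ?_
    rcases (A \ coordSource x).eq_empty_or_nonempty with h | h
    · have hAx : A ⊆ coordSource x := sdiff_eq_empty.1 h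
      have hym : MeasurableSet (coordSource y) := (isOpen_coordSource y).measurableSet
      have h0 : chartArea Ω y A = chartArea Ω y (A ∩ coordSource y) := by
        rw [chartArea_apply Ω y hA, chartArea_apply Ω y (hA.inter hym)]
        congr 2
        ext u
        exact ⟨fun ⟨h1, h2⟩ ↦ ⟨h1, h2, coordInv_mem_coordSource h1⟩, fun ⟨h1, h2⟩ ↦ ⟨h1, h2.1⟩⟩
      rw [h0, chartArea_eq_of_subset Ω (hA.inter hym) inter_subset_right
        (inter_subset_left.trans hAx)]
      refine (measure_mono inter_subset_left).trans ?_
      simp only [ν, Measure.add_apply]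
      exact le_self_add
    · have : ν A = ⊤ := by
        have hc : (Measure.count.restrict (coordSource x)ᶜ) A ≠ 0 := by
          rw [Measure.restrict_apply hA, ← sdiff_eq]
          exact (Measure.count_ne_zero h)
        simp only [ν, Measure.add_apply, Measure.smul_apply, smul_eq_mul, ENNReal.top_mul hc,
          add_top]
      rw [this]
      exact le_top
  refine (hle S).trans (le_of_eq ?_)
  have : S ∩ (coordSource x)ᶜ = ∅ := by
    rw [← sdiff_eq]; exact sdiff_eq_empty.2 hx
  simp [ν, Measure.restrict_apply hS, this]

/-- Positivity allows local multiplicities to be compared on overlaps. -/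
theorem areaMeasure_pos_of_isOpen (Ω : AreaForm M) {W : Set M} (hW : IsOpen W) (hne : W.Nonempty) :
    areaMeasure Ω W ≠ 0 := by
  obtain ⟨x, hx⟩ := hne
  set S := W ∩ coordSource x
  have hSm : MeasurableSet S := hW.measurableSet.inter (isOpen_coordSource x).measurableSet
  intro h0
  have h1 : areaMeasure Ω S = 0 := measure_mono_null inter_subset_left h0
  rw [areaMeasure_apply_of_subset Ω hSm inter_subset_right, chartArea_apply Ω x hSm] at h1
  have ho : IsOpen (coordTarget x ∩ coordInv x ⁻¹' S) :=
    (continuousOn_coordInv x).isOpen_inter_preimage (isOpen_coordTarget x)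
      (hW.inter (isOpen_coordSource x))
  have hne' : (coordTarget x ∩ coordInv x ⁻¹' S).Nonempty :=
    ⟨coord x x, coord_mem_coordTarget (mem_coordSource x), by
      rw [mem_preimage, coordInv_coord (mem_coordSource x)]; exact ⟨hx, mem_coordSource x⟩⟩
  refine (ho.measure_pos volume hne').ne' ?_
  have hae : AEMeasurable (fun u ↦ ENNReal.ofReal |chartDensity Ω x u|)
      (volume.restrict (coordTarget x ∩ coordInv x ⁻¹' S)) :=
    ENNReal.measurable_ofReal.comp_aemeasurable
      (((contDiffOn_chartDensity Ω x).continuousOn.mono inter_subset_left).abs.aemeasurable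
        ho.measurableSet)
  have h2 := (setLIntegral_eq_zero_iff' ho.measurableSet hae).1 h1
  have hsub : coordTarget x ∩ coordInv x ⁻¹' S ⊆
      {u | ¬(u ∈ coordTarget x ∩ coordInv x ⁻¹' S → ENNReal.ofReal |chartDensity Ω x u| = 0)} :=
    fun u hu h ↦ chartDensity_ne_zero Ω hu.1 (by simpa using h hu)
  exact measure_mono_null hsub (ae_iff.1 h2)

end AreaMeasure

/-! ### From local to global multiplicity -/

section LocalToGlobal

/-- A finitely additive set function on a compact connected space that is locally an integer
multiple of a measure is globally an integer multiple of it. -/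
theorem exists_int_mul_measure {M : Type*} [TopologicalSpace M] [CompactSpace M]
    [PreconnectedSpace M] [MeasurableSpace M] [BorelSpace M] (μ : Measure M) [IsFiniteMeasure μ]
    (hμ : ∀ W : Set M, IsOpen W → W.Nonempty → μ W ≠ 0) (Λ : Set M → ℝ)
    (hadd : ∀ T V, MeasurableSet T → MeasurableSet V → Λ T = Λ (T ∩ V) + Λ (T \ V))
    (hloc : ∀ x, ∃ W, IsOpen W ∧ x ∈ W ∧ ∃ k : ℤ, ∀ S, MeasurableSet S → S ⊆ W →
      Λ S = k * μ.real S) :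
    ∃ k : ℤ, Λ univ = k * μ.real univ := by
  choose W hWo hxW k hk using hloc
  -- Two multiples of `μ` agree on an overlap, which has positive finite measure, so the factors are
  -- equal.
  have hlc : IsLocallyConstant k := by
    refine (IsLocallyConstant.iff_exists_open k).2 fun x ↦ ⟨W x, hWo x, hxW x, fun y hy ↦ ?_⟩
    have ho : IsOpen (W x ∩ W y) := (hWo x).inter (hWo y)
    have h1 := hk x _ ho.measurableSet inter_subset_left
    rw [hk y _ ho.measurableSet inter_subset_right] at h1
    have hne : μ.real (W x ∩ W y) ≠ 0 := by
      rw [Measure.real, ENNReal.toReal_ne_zero]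
      exact ⟨hμ _ ho ⟨y, hy, hxW y⟩, measure_ne_top _ _⟩
    exact_mod_cast mul_right_cancel₀ hne h1
  rcases isEmpty_or_nonempty M with hM | ⟨⟨x₀⟩⟩
  · have h0 := hadd ∅ ∅ .empty .empty
    rw [empty_inter, empty_sdiff] at h0
    exact ⟨0, by rw [univ_eq_empty_iff.2 hM]; simp; linarith⟩
  refine ⟨k x₀, ?_⟩
  obtain ⟨V, -, hV, h⟩ : ∃ V : Set M, MeasurableSet V ∧ univ ⊆ V ∧
      ∀ T, MeasurableSet T → T ⊆ V → Λ T = k x₀ * μ.real T := by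
    -- Compactness replaces a finite subcover: additivity carries the formula from two sets to their
    -- union.
    refine isCompact_univ.induction_on (p := fun S ↦ ∃ V : Set M, MeasurableSet V ∧ S ⊆ V ∧
      ∀ T, MeasurableSet T → T ⊆ V → Λ T = k x₀ * μ.real T) ?_ ?_ ?_ ?_
    · refine ⟨∅, .empty, Subset.rfl, fun T _ hT ↦ ?_⟩
      have h0 := hadd ∅ ∅ .empty .empty
      rw [empty_inter, empty_sdiff] at h0
      rw [subset_empty_iff.1 hT]
      simp
      linarith
    · rintro S S' hS ⟨V, h1, h2, h3⟩
      exact ⟨V, h1, hS.trans h2, h3⟩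
    · rintro S S' ⟨V, h1, h2, h3⟩ ⟨V', h1', h2', h3'⟩
      refine ⟨V ∪ V', h1.union h1', union_subset_union h2 h2', fun T hT hTV ↦ ?_⟩
      rw [hadd T V hT h1, h3 _ (hT.inter h1) inter_subset_right,
        h3' _ (hT.diff h1) (fun z hz ↦ (hTV hz.1).resolve_left hz.2), ← mul_add,
        measureReal_inter_add_sdiff h1]
    · intro x _
      refine ⟨W x, mem_nhdsWithin_of_mem_nhds ((hWo x).mem_nhds (hxW x)), W x,
        (hWo x).measurableSet, Subset.rfl, fun T hT hTW ↦ ?_⟩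
      rw [hk x T hT hTW, hlc.apply_eq_of_isPreconnected isPreconnected_univ (mem_univ x)
        (mem_univ x₀)]
  exact h univ .univ hV

end LocalToGlobal

/-! ### Real functionals on chains -/

section ChainFunctional

/-- The additive extension to formal combinations of a real function. -/
def chainHom {X : Type*} (F : X → ℝ) : (X →₀ ℤ) →+ ℝ :=
  Finsupp.liftAddHom fun x ↦ (AddMonoidHom.mulRight (F x)).comp (Int.castAddHom ℝ)

theorem chainHom_apply {X : Type*} (F : X → ℝ) (c : X →₀ ℤ) :
    chainHom F c = c.sum fun x n ↦ (n : ℝ) * F x := by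
  simp [chainHom, Finsupp.liftAddHom_apply]
  rfl

theorem chainHom_single {X : Type*} (F : X → ℝ) (x : X) (n : ℤ) :
    chainHom F (Finsupp.single x n) = n * F x := by
  simp [chainHom]

theorem chainHom_congr {X : Type*} {F G : X → ℝ} {c : X →₀ ℤ} (h : ∀ x ∈ c.support, F x = G x) :
    chainHom F c = chainHom G c := by
  rw [chainHom_apply, chainHom_apply]
  exact Finsupp.sum_congr fun x hx ↦ by rw [h x hx]

theorem chainHom_boundary₁ {M : Type*} (F : M → ℝ) (c : Chain₁ M) :
    chainHom F (boundary₁ c) = chainHom (fun γ ↦ F (γ 1) - F (γ 0)) c := by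
  rw [← AddMonoidHom.comp_apply]
  congr 1
  refine Finsupp.addHom_ext fun γ n ↦ ?_
  simp [boundary₁, chainHom_single]
  ring

/-- The transpose of the boundary, which turns Stokes' theorem for single squares into Stokes'
theorem for chains. -/
theorem chainHom_boundary₂ {M : Type*} (F : (unitInterval → M) → ℝ) (D : Chain₂ M) :
    chainHom F (boundary₂ D) = chainHom (fun q ↦ F (fun s ↦ q (s, 0)) + F (fun t ↦ q (1, t))
      - F (fun s ↦ q (s, 1)) - F (fun t ↦ q (0, t))) D := by
  rw [← AddMonoidHom.comp_apply]
  congr 1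
  refine Finsupp.addHom_ext fun γ n ↦ ?_
  simp [boundary₂, chainHom_single]
  ring

theorem chainHom_eq_zero_of_mem_degenerate₁ {M : Type*} {F : (unitInterval → M) → ℝ}
    (hF : ∀ x, F (fun _ ↦ x) = 0) {c : Chain₁ M} (hc : c ∈ degenerate₁ M) : chainHom F c = 0 := by
  have : degenerate₁ M ≤ (chainHom F).ker := by
    rw [degenerate₁, AddSubgroup.closure_le]
    rintro _ ⟨x, rfl⟩
    simp [AddMonoidHom.mem_ker, chainHom_single, hF]
  exact this hc

end ChainFunctional

/-! ### Stokes' theorem for `C¹` chains -/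

section Stokes

/-- The closed unit square. -/
abbrev square : Set (ℝ × ℝ) := Icc (0 : ℝ) 1 ×ˢ Icc (0 : ℝ) 1

/-- The open unit square. -/
abbrev openSquare : Set (ℝ × ℝ) := Ioo (0 : ℝ) 1 ×ˢ Ioo (0 : ℝ) 1

theorem isOpen_openSquare : IsOpen openSquare := isOpen_Ioo.prod isOpen_Ioo

theorem openSquare_subset : openSquare ⊆ square :=
  prod_mono Ioo_subset_Icc_self Ioo_subset_Icc_self

theorem square_mem_nhds {p : ℝ × ℝ} (hp : p ∈ openSquare) : square ∈ 𝓝 p :=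
  mem_of_superset (isOpen_openSquare.mem_nhds hp) openSquare_subset

theorem uniqueDiffOn_square : UniqueDiffOn ℝ square :=
  (uniqueDiffOn_Icc zero_lt_one).prod (uniqueDiffOn_Icc zero_lt_one)

theorem isCompact_square : IsCompact square := isCompact_Icc.prod isCompact_Icc

theorem ae_eq_openSquare : square =ᵐ[volume] openSquare := by
  rw [Measure.volume_eq_prod]
  exact Measure.set_prod_ae_eq Ioo_ae_eq_Icc.symm Ioo_ae_eq_Icc.symm

/-- The retraction of the plane to the closed unit square. -/
def clampSquare (p : ℝ × ℝ) : ℝ × ℝ :=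
  (projIcc (0 : ℝ) 1 zero_le_one p.1, projIcc (0 : ℝ) 1 zero_le_one p.2)

theorem continuous_clampSquare : Continuous clampSquare := by
  unfold clampSquare
  fun_prop

theorem clampSquare_mem (p : ℝ × ℝ) : clampSquare p ∈ square :=
  ⟨Subtype.coe_prop _, Subtype.coe_prop _⟩

theorem clampSquare_of_mem {p : ℝ × ℝ} (hp : p ∈ square) : clampSquare p = p := by
  obtain ⟨s, t⟩ := p
  simp [clampSquare, projIcc_of_mem zero_le_one hp.1, projIcc_of_mem zero_le_one hp.2]

theorem extendSquare_clampSquare {M : Type*} (q : unitInterval × unitInterval → M) (p : ℝ × ℝ) :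
    extendSquare q (clampSquare p) = extendSquare q p := by
  simp [extendSquare, clampSquare]

/-- The density of `dA ∧ dB` on the closed unit square. -/
def wedgeDensity (A B : ℝ × ℝ → ℝ) (p : ℝ × ℝ) : ℝ :=
  fderivWithin ℝ A square p (1, 0) * fderivWithin ℝ B square p (0, 1)
    - fderivWithin ℝ A square p (0, 1) * fderivWithin ℝ B square p (1, 0)

/-- The integral of `A dB` along the curve `γ`. -/
def curveIntegral {M : Type*} (a b : M → ℝ) (γ : unitInterval → M) : ℝ :=
  ∫ s in (0 : ℝ)..1, a (IccExtend zero_le_one γ s) * deriv (fun s ↦ b (IccExtend zero_le_one γ s)) s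

theorem curveIntegral_const {M : Type*} (a b : M → ℝ) (x : M) :
    curveIntegral a b (fun _ ↦ x) = 0 := by
  simp [curveIntegral, IccExtend]

/-- The constant extension of `γ` may fail to be differentiable at 0 and 1, where `deriv` is then
meaningless; these points are negligible. -/
theorem integral_mul_eq_curveIntegral {M : Type*} {a b : M → ℝ} {γ : unitInterval → M}
    {A B' : ℝ → ℝ} (hA : ∀ s, A s = a (IccExtend zero_le_one γ s))
    (hB : ∀ s ∈ Ioo (0 : ℝ) 1, HasDerivAt (fun s ↦ b (IccExtend zero_le_one γ s)) (B' s) s) :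
    ∫ s in (0 : ℝ)..1, A s * B' s = curveIntegral a b γ := by
  rw [curveIntegral, intervalIntegral.integral_of_le zero_le_one,
    intervalIntegral.integral_of_le zero_le_one, integral_Ioc_eq_integral_Ioo,
    integral_Ioc_eq_integral_Ioo]
  exact setIntegral_congr_fun measurableSet_Ioo fun s hs ↦ by simp only [hA, (hB s hs).deriv]

theorem hasDerivAt_fst_of_contDiffOn_square {A : ℝ × ℝ → ℝ} (hA : ContDiffOn ℝ 1 A square) {s t : ℝ}
    (hs : s ∈ Ioo (0 : ℝ) 1) (ht : t ∈ Icc (0 : ℝ) 1) :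
    HasDerivAt (fun x ↦ A (x, t)) (fderivWithin ℝ A square (s, t) (1, 0)) s := by
  have h1 := (hA.differentiableOn one_ne_zero (s, t)
    ⟨Ioo_subset_Icc_self hs, ht⟩).hasFDerivWithinAt
  have h2 : HasDerivWithinAt (fun x : ℝ ↦ (x, t)) (1, 0) (Icc 0 1) s :=
    ((hasDerivAt_id s).prodMk (hasDerivAt_const s t)).hasDerivWithinAt
  have h3 : MapsTo (fun x : ℝ ↦ (x, t)) (Icc 0 1) square := fun x hx ↦ ⟨hx, ht⟩
  exact (h1.comp_hasDerivWithinAt s h2 h3).hasDerivAt (Icc_mem_nhds hs.1 hs.2)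

theorem hasDerivAt_snd_of_contDiffOn_square {A : ℝ × ℝ → ℝ} (hA : ContDiffOn ℝ 1 A square) {s t : ℝ}
    (hs : s ∈ Icc (0 : ℝ) 1) (ht : t ∈ Ioo (0 : ℝ) 1) :
    HasDerivAt (fun x ↦ A (s, x)) (fderivWithin ℝ A square (s, t) (0, 1)) t := by
  have h1 := (hA.differentiableOn one_ne_zero (s, t)
    ⟨hs, Ioo_subset_Icc_self ht⟩).hasFDerivWithinAt
  have h2 : HasDerivWithinAt (fun x : ℝ ↦ (s, x)) (0, 1) (Icc 0 1) t :=
    ((hasDerivAt_const t s).prodMk (hasDerivAt_id t)).hasDerivWithinAt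
  have h3 : MapsTo (fun x : ℝ ↦ (s, x)) (Icc 0 1) square := fun x hx ↦ ⟨hs, hx⟩
  exact (h1.comp_hasDerivWithinAt t h2 h3).hasDerivAt (Icc_mem_nhds ht.1 ht.2)

variable {M : Type*} [TopologicalSpace M] [ChartedSpace Plane M]

theorem continuous_extendSquare {q : unitInterval × unitInterval → M} (hq : IsC1Square q) :
    Continuous (extendSquare q) := by
  have := (show ContMDiffOn _ _ _ _ _ from hq).continuousOn.comp_continuous continuous_clampSquare
    clampSquare_mem
  exact this.congr fun p ↦ extendSquare_clampSquare q p

theorem contDiffOn_comp_extendSquare {q : unitInterval × unitInterval → M} (hq : IsC1Square q)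
    {a : M → ℝ} (ha : ContMDiff (𝓡 2) 𝓘(ℝ, ℝ) 1 a) :
    ContDiffOn ℝ 1 (fun p ↦ a (extendSquare q p)) square :=
  (ha.comp_contMDiffOn (show ContMDiffOn _ _ _ _ _ from hq)).contDiffOn

/-- Stokes' theorem for the form `a db` on a `C¹` square. -/
theorem integral_wedgeDensity_eq {q : unitInterval × unitInterval → M} (hq : IsC1Square q)
    {a b : M → ℝ} (ha : ContMDiff (𝓡 2) 𝓘(ℝ, ℝ) 1 a) (hb : ContMDiff (𝓡 2) 𝓘(ℝ, ℝ) 1 b) :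
    ∫ p in square, wedgeDensity (fun p ↦ a (extendSquare q p)) (fun p ↦ b (extendSquare q p)) p
      = curveIntegral a b (fun s ↦ q (s, 0)) + curveIntegral a b (fun t ↦ q (1, t))
        - curveIntegral a b (fun s ↦ q (s, 1)) - curveIntegral a b (fun t ↦ q (0, t)) := by
  set A : ℝ × ℝ → ℝ := fun p ↦ a (extendSquare q p) with hAdef
  set B : ℝ × ℝ → ℝ := fun p ↦ b (extendSquare q p) with hBdef
  have hA : ContDiffOn ℝ 1 A square := contDiffOn_comp_extendSquare hq ha
  have hB : ContDiffOn ℝ 1 B square := contDiffOn_comp_extendSquare hq hb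
  -- Composition with the retraction makes the derivatives continuous on the whole plane, as the
  -- form of Green's theorem used here demands, without changing them on the square.
  have hcont : ∀ {F : ℝ × ℝ → ℝ}, ContDiffOn ℝ 1 F square → ∀ w : ℝ × ℝ,
      Continuous fun p ↦ fderivWithin ℝ F square (clampSquare p) w := fun hF w ↦
    ((hF.continuousOn_fderivWithin uniqueDiffOn_square le_rfl).comp_continuous
      continuous_clampSquare clampSquare_mem).clm_apply continuous_const
  have cA : Continuous A := ha.continuous.comp (continuous_extendSquare hq)
  have cB : Continuous B := hb.continuous.comp (continuous_extendSquare hq)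
  have dfst : ∀ {F : ℝ × ℝ → ℝ}, ContDiffOn ℝ 1 F square → ∀ s ∈ Ioo (0 : ℝ) 1,
      ∀ t ∈ Icc (0 : ℝ) 1, HasDerivAt (fun x ↦ F (x, t))
        (fderivWithin ℝ F square (clampSquare (s, t)) (1, 0)) s := fun hF s hs t ht ↦ by
    rw [clampSquare_of_mem ⟨Ioo_subset_Icc_self hs, ht⟩]
    exact hasDerivAt_fst_of_contDiffOn_square hF hs ht
  have dsnd : ∀ {F : ℝ × ℝ → ℝ}, ContDiffOn ℝ 1 F square → ∀ s ∈ Icc (0 : ℝ) 1,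
      ∀ t ∈ Ioo (0 : ℝ) 1, HasDerivAt (fun x ↦ F (s, x))
        (fderivWithin ℝ F square (clampSquare (s, t)) (0, 1)) t := fun hF s hs t ht ↦ by
    rw [clampSquare_of_mem ⟨hs, Ioo_subset_Icc_self ht⟩]
    exact hasDerivAt_snd_of_contDiffOn_square hF hs ht
  have h0 : (0 : ℝ) ∈ Icc (0 : ℝ) 1 := by simp
  have h1 : (1 : ℝ) ∈ Icc (0 : ℝ) 1 := by simp
  have hext0 : ∀ s, extendSquare q (s, 0) = IccExtend zero_le_one (fun s ↦ q (s, 0)) s := fun s ↦ by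
    simp only [extendSquare, IccExtend, Function.comp_apply, projIcc_left]; rfl
  have hext1 : ∀ s, extendSquare q (s, 1) = IccExtend zero_le_one (fun s ↦ q (s, 1)) s := fun s ↦ by
    simp only [extendSquare, IccExtend, Function.comp_apply, projIcc_right]; rfl
  have hext2 : ∀ t, extendSquare q (0, t) = IccExtend zero_le_one (fun t ↦ q (0, t)) t := fun s ↦ by
    simp only [extendSquare, IccExtend, Function.comp_apply, projIcc_left]; rfl
  have hext3 : ∀ t, extendSquare q (1, t) = IccExtend zero_le_one (fun t ↦ q (1, t)) t := fun s ↦ by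
    simp only [extendSquare, IccExtend, Function.comp_apply, projIcc_right]; rfl
  have key := integral_wedge_eq_boundary cA cB (hcont hA (1, 0)) (hcont hA (0, 1))
    (hcont hB (1, 0)) (hcont hB (0, 1)) (dfst hA) (dfst hB) (dsnd hA) (dsnd hB)
  rw [integral_mul_eq_curveIntegral (a := a) (b := b) (fun s ↦ by rw [hAdef, ← hext0])
      (fun s hs ↦ by simpa only [hBdef, hext0] using dfst hB s hs 0 h0),
    integral_mul_eq_curveIntegral (a := a) (b := b) (fun s ↦ by rw [hAdef, ← hext3])
      (fun s hs ↦ by simpa only [hBdef, hext3] using dsnd hB 1 h1 s hs),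
    integral_mul_eq_curveIntegral (a := a) (b := b) (fun s ↦ by rw [hAdef, ← hext1])
      (fun s hs ↦ by simpa only [hBdef, hext1] using dfst hB s hs 1 h1),
    integral_mul_eq_curveIntegral (a := a) (b := b) (fun s ↦ by rw [hAdef, ← hext2])
      (fun s hs ↦ by simpa only [hBdef, hext2] using dsnd hB 0 h0 s hs)] at key
  rw [← key]
  refine setIntegral_congr_fun (measurableSet_Icc.prod measurableSet_Icc) fun p hp ↦ ?_
  simp only [wedgeDensity, clampSquare_of_mem hp]

/-- Stokes' theorem for the form `a db` on a `C¹` chain with degenerate boundary. -/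
theorem chainHom_integral_wedgeDensity_eq_zero {Z : Chain₂ M} (hZ : ∀ q ∈ Z.support, IsC1Square q)
    (hbd : boundary₂ Z ∈ degenerate₁ M) {a b : M → ℝ} (ha : ContMDiff (𝓡 2) 𝓘(ℝ, ℝ) 1 a)
    (hb : ContMDiff (𝓡 2) 𝓘(ℝ, ℝ) 1 b) :
    chainHom (fun q ↦ ∫ p in square, wedgeDensity (fun p ↦ a (extendSquare q p))
      (fun p ↦ b (extendSquare q p)) p) Z = 0 := by
  rw [chainHom_congr fun q hq ↦ integral_wedgeDensity_eq (hZ q hq) ha hb, ← chainHom_boundary₂]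
  exact chainHom_eq_zero_of_mem_degenerate₁ (curveIntegral_const a b) hbd

end Stokes

/-! ### Extension by zero of functions in a chart -/

section Lift

variable {M : Type*} [TopologicalSpace M] [ChartedSpace Plane M]

open Classical in
/-- The function on `M` that is `g` in the coordinates of the preferred chart at `x`, and zero
outside the domain of this chart. -/
def chartLift (x : M) (g : ℝ × ℝ → ℝ) (m : M) : ℝ := if m ∈ coordSource x then g (coord x m) else 0

theorem chartLift_of_mem {x m : M} (hm : m ∈ coordSource x) (g : ℝ × ℝ → ℝ) :
    chartLift x g m = g (coord x m) := if_pos hm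

variable [IsManifold (𝓡 2) ∞ M]

/-- The support on `M` is the image of a compact set, hence closed since `M` is Hausdorff. -/
theorem eventually_chartLift_eq_zero [T2Space M] {x m : M} {g : ℝ × ℝ → ℝ}
    (hg : HasCompactSupport g) (hgx : tsupport g ⊆ coordTarget x)
    (hm : m ∉ coordInv x '' tsupport g) : ∀ᶠ z in 𝓝 m, chartLift x g z = 0 := by
  have hcl : IsClosed (coordInv x '' tsupport g) :=
    (hg.isCompact.image_of_continuousOn ((continuousOn_coordInv x).mono hgx)).isClosed
  filter_upwards [hcl.isOpen_compl.mem_nhds hm] with z hz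
  by_cases hzs : z ∈ coordSource x
  · rw [chartLift_of_mem hzs]
    by_contra hne
    exact hz ⟨coord x z, subset_tsupport _ hne, coordInv_coord hzs⟩
  · exact if_neg hzs

theorem contMDiff_chartLift [T2Space M] {x : M} {g : ℝ × ℝ → ℝ} (hg : ContDiff ℝ ∞ g)
    (hgc : HasCompactSupport g) (hgx : tsupport g ⊆ coordTarget x) :
    ContMDiff (𝓡 2) 𝓘(ℝ, ℝ) ∞ (chartLift x g) := by
  intro m
  by_cases hm : m ∈ coordInv x '' tsupport g
  · have hms : m ∈ coordSource x := by
      obtain ⟨u, hu, rfl⟩ := hm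
      exact coordInv_mem_coordSource (hgx hu)
    have h1 : ContMDiffAt (𝓡 2) 𝓘(ℝ, ℝ) ∞ (fun z ↦ g (coord x z)) m :=
      hg.contMDiff.contMDiffAt.comp m
        ((contMDiffOn_coord x).contMDiffAt ((isOpen_coordSource x).mem_nhds hms))
    refine h1.congr_of_eventuallyEq ?_
    filter_upwards [(isOpen_coordSource x).mem_nhds hms] with z hz using chartLift_of_mem hz g
  · exact contMDiffAt_const.congr_of_eventuallyEq (eventually_chartLift_eq_zero hgc hgx hm)

end Lift

/-! ### Chains with degenerate boundary have integral area -/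

section Multiplicity

variable {M : Type*} [TopologicalSpace M] [ChartedSpace Plane M]

/-- The part of the open unit square that the square `q` maps to the points with coordinates in
`B`. -/
def chartDomain (x : M) (q : unitInterval × unitInterval → M) (B : Set (ℝ × ℝ)) : Set (ℝ × ℝ) :=
  openSquare ∩ extendSquare q ⁻¹' (coordSource x ∩ coord x ⁻¹' B)

theorem contMDiffAt_extendSquare {q : unitInterval × unitInterval → M} (hq : IsC1Square q)
    {p : ℝ × ℝ} (hp : p ∈ openSquare) : ContMDiffAt 𝓘(ℝ, ℝ × ℝ) (𝓡 2) 1 (extendSquare q) p :=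
  ContMDiffOn.contMDiffAt hq (square_mem_nhds hp)

variable [IsManifold (𝓡 2) ∞ M]

theorem isOpen_coord_preimage (x : M) {B : Set (ℝ × ℝ)} (hB : IsOpen B) :
    IsOpen (coordSource x ∩ coord x ⁻¹' B) :=
  (continuousOn_coord x).isOpen_inter_preimage (isOpen_coordSource x) hB

variable {q : unitInterval × unitInterval → M} {x : M} {B : Set (ℝ × ℝ)}

theorem isOpen_chartDomain (hq : IsC1Square q) (hB : IsOpen B) : IsOpen (chartDomain x q B) :=
  isOpen_openSquare.inter ((isOpen_coord_preimage x hB).preimage (continuous_extendSquare hq))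

theorem contDiffOn_coord_extendSquare (hq : IsC1Square q) :
    ContDiffOn ℝ 1 (fun p ↦ coord x (extendSquare q p)) (chartDomain x q B) := by
  intro p hp
  have h1 : ContMDiffAt (𝓡 2) 𝓘(ℝ, ℝ × ℝ) 1 (coord x) (extendSquare q p) :=
    ((contMDiffOn_coord x).contMDiffAt ((isOpen_coordSource x).mem_nhds hp.2.1)).of_le (by simp)
  exact (h1.comp p (contMDiffAt_extendSquare hq hp.1)).contDiffAt.contDiffWithinAt

theorem pullDensity_extendSquare (Ω : AreaForm M) (hq : IsC1Square q) {p : ℝ × ℝ}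
    (hp : p ∈ chartDomain x q B) : pullDensity Ω (extendSquare q) p =
      chartDensity Ω x (coord x (extendSquare q p)) *
        (fderiv ℝ (fun p ↦ coord x (extendSquare q p)) p).det :=
  pullDensity_eq_chartDensity_mul_det Ω
    ((contMDiffAt_extendSquare hq hp.1).mdifferentiableAt one_ne_zero) hp.2.1

theorem continuousOn_pullDensityWithin_square (Ω : AreaForm M) (hq : IsC1Square q) :
    ContinuousOn (pullDensityWithin Ω (extendSquare q) square) square :=
  (contDiffOn_pullDensityWithin Ω (n := 0) (by simp) (by rw [zero_add]; exact hq)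
    uniqueDiffOn_square).continuousOn

theorem integrableOn_pullDensity (Ω : AreaForm M) (hq : IsC1Square q) :
    IntegrableOn (pullDensity Ω (extendSquare q)) openSquare := by
  have h := ((continuousOn_pullDensityWithin_square Ω hq).integrableOn_compact
    isCompact_square (μ := volume)).mono_set openSquare_subset
  exact h.congr_fun (fun p hp ↦ pullDensityWithin_of_mem_nhds (square_mem_nhds hp))
    isOpen_openSquare.measurableSet

theorem squareIntegral_eq (Ω : AreaForm M) (q : unitInterval × unitInterval → M) :
    squareIntegral Ω q = ∫ p in openSquare, pullDensity Ω (extendSquare q) p := by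
  rw [show squareIntegral Ω q = ∫ p in square, pullDensityWithin Ω (extendSquare q) square p from rfl,
    setIntegral_congr_set ae_eq_openSquare]
  exact setIntegral_congr_fun isOpen_openSquare.measurableSet fun p hp ↦
    pullDensityWithin_of_mem_nhds (square_mem_nhds hp)

/-- The Jacobian is the pulled back density, integrable on the square, divided by the chart density,
which is bounded away from zero on `K`. -/
theorem integrableOn_det_fderiv (Ω : AreaForm M) (hq : IsC1Square q) (hB : IsOpen B)
    {K : Set (ℝ × ℝ)} (hK : IsCompact K) (hBK : B ⊆ K) (hKx : K ⊆ coordTarget x) :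
    IntegrableOn (fun p ↦ (fderiv ℝ (fun p ↦ coord x (extendSquare q p)) p).det)
      (chartDomain x q B) := by
  have hO := isOpen_chartDomain (x := x) hq hB
  obtain ⟨C, hC⟩ := hK.exists_bound_of_continuousOn
    (((contDiffOn_chartDensity Ω x).continuousOn.mono hKx).inv₀
      fun u hu ↦ chartDensity_ne_zero Ω (hKx hu))
  have hdet : ContinuousOn (fun p ↦ (fderiv ℝ (fun p ↦ coord x (extendSquare q p)) p).det)
      (chartDomain x q B) :=
    ContinuousLinearMap.continuous_det.comp_continuousOn
      ((contDiffOn_coord_extendSquare hq).continuousOn_fderiv_of_isOpen hO le_rfl)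
  refine (((integrableOn_pullDensity Ω hq).mono_set inter_subset_left).const_mul C).mono
    (hdet.aestronglyMeasurable hO.measurableSet) ?_
  filter_upwards [ae_restrict_mem hO.measurableSet] with p hp
  rw [pullDensity_extendSquare Ω hq hp]
  have hv : coord x (extendSquare q p) ∈ K := hBK hp.2.2
  have h1 := hC _ hv
  have h2 := chartDensity_ne_zero Ω (hKx hv)
  rw [norm_mul, norm_mul]
  calc ‖(fderiv ℝ (fun p ↦ coord x (extendSquare q p)) p).det‖
      = ‖(chartDensity Ω x (coord x (extendSquare q p)))⁻¹‖ *
        (‖chartDensity Ω x (coord x (extendSquare q p))‖ *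
          ‖(fderiv ℝ (fun p ↦ coord x (extendSquare q p)) p).det‖) := by
        rw [← mul_assoc, ← norm_mul, inv_mul_cancel₀ h2, norm_one, one_mul]
    _ ≤ _ := by
        gcongr
        exact h1.trans (le_abs_self C)

/-- The linear function `g` is chosen so that `df ∧ dg` is the derivative of `f` along `w` times
`du₁ ∧ du₂`. Only its values on `B` matter, since `f` is supported there; this leaves room for a
cutoff. -/
theorem integral_wedgeDensity_chartLift [T2Space M] (hq : IsC1Square q) (hB : IsOpen B)
    (hBx : B ⊆ coordTarget x) {f g : ℝ × ℝ → ℝ} (hf : ContDiff ℝ ∞ f) (hfc : HasCompactSupport f)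
    (hfB : tsupport f ⊆ B) (w : ℝ × ℝ) (hg : ∀ u ∈ B, g u = w.1 * u.2 - w.2 * u.1) :
    ∫ p in square, wedgeDensity (fun p ↦ chartLift x f (extendSquare q p))
        (fun p ↦ chartLift x g (extendSquare q p)) p
      = ∫ p in chartDomain x q B, fderiv ℝ f (coord x (extendSquare q p)) w *
          (fderiv ℝ (fun p ↦ coord x (extendSquare q p)) p).det := by
  have hO := isOpen_chartDomain (x := x) hq hB
  rw [setIntegral_congr_set ae_eq_openSquare]
  have hcongr : ∀ {h k : ℝ × ℝ → ℝ} {p}, p ∈ openSquare → k =ᶠ[𝓝 p] h →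
      fderivWithin ℝ k square p = fderiv ℝ h p := fun {h k p} hp hk ↦ by
    rw [fderivWithin_of_mem_nhds (square_mem_nhds hp), hk.fderiv_eq]
  rw [setIntegral_eq_of_subset_of_forall_sdiff_eq_zero isOpen_openSquare.measurableSet
    (s := chartDomain x q B) inter_subset_left]
  · refine setIntegral_congr_fun hO.measurableSet fun p hp ↦ ?_
    set v : ℝ × ℝ → ℝ × ℝ := fun p ↦ coord x (extendSquare q p) with hv
    have hvd : HasFDerivAt v (fderiv ℝ v p) p :=
      (((contDiffOn_coord_extendSquare (B := B) hq).contDiffAt (hO.mem_nhds hp)).differentiableAt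
        one_ne_zero).hasFDerivAt
    have hA : (fun p ↦ chartLift x f (extendSquare q p)) =ᶠ[𝓝 p] f ∘ v := by
      filter_upwards [hO.mem_nhds hp] with z hz using chartLift_of_mem hz.2.1 f
    have hB' : (fun p ↦ chartLift x g (extendSquare q p)) =ᶠ[𝓝 p]
        fun z ↦ w.1 * (v z).2 - w.2 * (v z).1 := by
      filter_upwards [hO.mem_nhds hp] with z hz
      rw [chartLift_of_mem hz.2.1, hg _ hz.2.2]
    have h1 := ((hf.differentiable (by simp) (v p)).hasFDerivAt.comp p hvd).fderiv
    have h2 : fderiv ℝ (fun z ↦ w.1 * (v z).2 - w.2 * (v z).1) p = _ :=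
      ((hvd.snd.const_mul w.1).sub (hvd.fst.const_mul w.2)).fderiv
    have hdec : ∀ z : ℝ × ℝ, fderiv ℝ f (v p) z =
        z.1 * fderiv ℝ f (v p) (1, 0) + z.2 * fderiv ℝ f (v p) (0, 1) := fun z ↦ by
      rw [← smul_eq_mul, ← smul_eq_mul, ← map_smul, ← map_smul, ← map_add]; simp
    simp only [wedgeDensity]
    rw [hcongr hp.1 hA, hcongr hp.1 hB', h1, h2, det_prod_eq, hdec w]
    simp only [ContinuousLinearMap.comp_apply, sub_apply, smul_apply, smul_eq_mul,
      ContinuousLinearMap.coe_fst', ContinuousLinearMap.coe_snd']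
    rw [hdec (fderiv ℝ v p (1, 0)), hdec (fderiv ℝ v p (0, 1))]
    ring
  · rintro p ⟨hp, hpO⟩
    have hz : (fun p ↦ chartLift x f (extendSquare q p)) =ᶠ[𝓝 p] fun _ ↦ 0 := by
      refine (continuous_extendSquare hq).continuousAt.eventually
        (eventually_chartLift_eq_zero hfc (hfB.trans hBx) ?_)
      rintro ⟨u, hu, huq⟩
      have hux := hBx (hfB hu)
      refine hpO ⟨hp, ?_⟩
      rw [mem_preimage, ← huq]
      exact ⟨coordInv_mem_coordSource hux, by rw [mem_preimage, coord_coordInv hux]; exact hfB hu⟩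
    simp only [wedgeDensity]
    rw [hcongr hp hz]
    simp

/-- A nonvanishing continuous function on a connected set keeps its sign. It compares the
orientation of `Ω` with that of the chart. -/
theorem exists_sign_chartDensity (Ω : AreaForm M) (hB : IsPreconnected B) (hBx : B ⊆ coordTarget x) :
    ∃ σ : ℤ, ∀ u ∈ B, chartDensity Ω x u = σ * |chartDensity Ω x u| := by
  by_cases h : ∃ a ∈ B, chartDensity Ω x a < 0
  · obtain ⟨a, ha, han⟩ := h
    refine ⟨-1, fun u hu ↦ ?_⟩
    have : chartDensity Ω x u < 0 := by
      by_contra! hcon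
      obtain ⟨z, hz, hz0⟩ := hB.intermediate_value ha hu
        ((contDiffOn_chartDensity Ω x).continuousOn.mono hBx) ⟨han.le, hcon⟩
      exact chartDensity_ne_zero Ω (hBx hz) hz0
    rw [abs_of_neg this]
    push_cast; ring
  · push Not at h
    exact ⟨1, fun u hu ↦ by rw [abs_of_nonneg (h u hu)]; simp⟩

variable [MeasurableSpace M] [BorelSpace M]

theorem setIntegral_abs_chartDensity (Ω : AreaForm M) {S : Set M} (hS : MeasurableSet S)
    (hSx : S ⊆ coordSource x) :
    ∫ u in coord x '' S, |chartDensity Ω x u| = (areaMeasure Ω).real S := by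
  rw [Measure.real, areaMeasure_apply_of_subset Ω hS hSx, chartArea_apply Ω x hS, coord_image_eq hSx]
  rw [integral_eq_lintegral_of_nonneg_ae (ae_of_all _ fun _ ↦ abs_nonneg _)]
  exact (((contDiffOn_chartDensity Ω x).continuousOn.mono inter_subset_left).abs).aestronglyMeasurable
    (measurableSet_coordTarget_inter x hS)

/-- The signed area with multiplicity of the part of the chain `Z` in the set `S`. -/
def chainArea (Ω : AreaForm M) (Z : Chain₂ M) (S : Set M) : ℝ :=
  chainHom (fun q ↦ ∫ p in openSquare ∩ extendSquare q ⁻¹' S, pullDensity Ω (extendSquare q) p) Z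

/-- A chain with degenerate boundary covers the points of `M` near `x` with constant multiplicity. -/
theorem exists_chainArea_eq [T2Space M] (Ω : AreaForm M) {Z : Chain₂ M}
    (hZ : ∀ q ∈ Z.support, IsC1Square q) (hbd : boundary₂ Z ∈ degenerate₁ M) (x : M) :
    ∃ W, IsOpen W ∧ x ∈ W ∧ ∃ k : ℤ, ∀ S, MeasurableSet S → S ⊆ W →
      chainArea Ω Z S = k * (areaMeasure Ω).real S := by
  set y₀ := coord x x with hy₀
  obtain ⟨ε, hε, hKx⟩ := Metric.nhds_basis_closedBall.mem_iff.1
    ((isOpen_coordTarget x).mem_nhds (coord_mem_coordTarget (mem_coordSource x)))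
  -- Multiplicities are defined on the ball of radius `2R`, the cutoff lives in radius `3R = ε`, and
  -- constancy will hold in radius `R`.
  set R := ε / 3 with hR
  have hRpos : 0 < R := by positivity
  set B := Metric.ball y₀ (2 * R) with hBdef
  have hBK : B ⊆ Metric.closedBall y₀ ε :=
    Metric.ball_subset_closedBall.trans (Metric.closedBall_subset_closedBall (by linarith))
  have hBx : B ⊆ coordTarget x := hBK.trans hKx
  have hB : IsOpen B := Metric.isOpen_ball
  have hBR : Metric.ball y₀ R ⊆ B := Metric.ball_subset_ball (by linarith)
  have hmult : ∀ q ∈ Z.support, ∃ N : ℝ × ℝ → ℝ, Integrable N ∧ (∀ y, ∃ n : ℤ, N y = n) ∧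
      ∀ g : ℝ × ℝ → ℝ, Measurable g → (∃ C, ∀ y, ‖g y‖ ≤ C) →
        ∫ p in chartDomain x q B, g (coord x (extendSquare q p)) *
          (fderiv ℝ (fun p ↦ coord x (extendSquare q p)) p).det = ∫ y, g y * N y := fun q hq ↦
    exists_multiplicity (isOpen_chartDomain (hZ q hq) hB) (contDiffOn_coord_extendSquare (hZ q hq))
      (integrableOn_det_fderiv Ω (hZ q hq) hB (isCompact_closedBall y₀ ε) hBK hKx)
  choose! N hNi hNz hN using hmult
  -- The multiplicity with which the whole chain covers a point of the chart.
  set Nt : ℝ × ℝ → ℝ := fun y ↦ ∑ q ∈ Z.support, (Z q : ℝ) * N q y with hNt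
  have hNti : Integrable Nt := integrable_finsetSum _ fun q hq ↦ (hNi q hq).const_mul _
  have hsum : ∀ g : ℝ × ℝ → ℝ, Measurable g → (∃ C, ∀ y, ‖g y‖ ≤ C) →
      chainHom (fun q ↦ ∫ p in chartDomain x q B, g (coord x (extendSquare q p)) *
        (fderiv ℝ (fun p ↦ coord x (extendSquare q p)) p).det) Z = ∫ y, g y * Nt y := by
    intro g hg ⟨C, hC⟩
    rw [chainHom_apply, Finsupp.sum]
    simp only [hNt, Finset.mul_sum]
    rw [integral_finsetSum]
    · refine Finset.sum_congr rfl fun q hq ↦ ?_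
      rw [hN q hq g hg ⟨C, hC⟩, ← integral_const_mul]
      exact integral_congr_ae (ae_of_all _ fun y ↦ by simp only; ring)
    · intro q hq
      exact ((hNi q hq).const_mul _).bdd_mul hg.aestronglyMeasurable (ae_of_all _ hC)
  have hconst := ae_eq_const_of_integral_fderiv_mul_eq_zero (μ := volume) hNti.locallyIntegrable
    (y₀ := y₀) hRpos (fun f hf hfc hfB w ↦ by
      -- The cutoff makes the linear function a global function on `M`, so that Stokes' theorem on
      -- the chain `Z` applies to `f dg`.
      set χ : ContDiffBump y₀ := ⟨2 * R, 3 * R, by positivity, by linarith⟩ with hχ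
      set g : ℝ × ℝ → ℝ := fun u ↦ χ u * (w.1 * u.2 - w.2 * u.1) with hg
      have hgsm : ContDiff ℝ ∞ g := by
        refine χ.contDiff.mul ?_
        fun_prop
      have hgc : HasCompactSupport g := χ.hasCompactSupport.mul_right
      have hgx : tsupport g ⊆ coordTarget x := by
        refine (tsupport_mul_subset_left).trans ?_
        rw [χ.tsupport_eq]
        refine (Metric.closedBall_subset_closedBall ?_).trans hKx
        simp only [hχ, hR]; linarith
      have hgB : ∀ u ∈ B, g u = w.1 * u.2 - w.2 * u.1 := fun u hu ↦ by
        simp only [hg]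
        rw [χ.one_of_mem_closedBall (Metric.ball_subset_closedBall hu), one_mul]
      have h1 := chainHom_integral_wedgeDensity_eq_zero hZ hbd
        ((contMDiff_chartLift hf hfc (hfB.trans hBx)).of_le (by simp))
        ((contMDiff_chartLift hgsm hgc hgx).of_le (by simp))
      rw [chainHom_congr fun q hq ↦ integral_wedgeDensity_chartLift (hZ q hq) hB hBx hf hfc hfB w hgB]
        at h1
      have hc : Continuous fun y ↦ fderiv ℝ f y w :=
        (hf.continuous_fderiv (by simp)).clm_apply continuous_const
      rw [← h1, hsum (fun y ↦ fderiv ℝ f y w) hc.measurable]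
      exact (hfc.fderiv_apply ℝ w).exists_bound_of_continuous hc)
  obtain ⟨y₁, hy₁⟩ := hconst
  obtain ⟨k, hk⟩ : ∃ k : ℤ, Nt y₁ = k := by
    choose! n hn using hNz
    exact ⟨∑ q ∈ Z.support, Z q * n q y₁, by
      push_cast
      exact Finset.sum_congr rfl fun q hq ↦ by rw [hn q hq]⟩
  obtain ⟨σ, hσ⟩ := exists_sign_chartDensity Ω (convex_ball y₀ (2 * R)).isPreconnected hBx
  -- The factor `σ` appears because the area of the chain is signed by `Ω` and the area measure uses
  -- the absolute value of the density.
  refine ⟨coordSource x ∩ coord x ⁻¹' Metric.ball y₀ R, isOpen_coord_preimage x Metric.isOpen_ball,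
    ⟨mem_coordSource x, Metric.mem_ball_self hRpos⟩, k * σ, fun S hS hSW ↦ ?_⟩
  have hSx : S ⊆ coordSource x := hSW.trans inter_subset_left
  have hSB : coord x '' S ⊆ Metric.ball y₀ R := by
    rintro _ ⟨m, hm, rfl⟩
    exact (hSW hm).2
  have hSm : MeasurableSet (coord x '' S) := by
    rw [coord_image_eq hSx]; exact measurableSet_coordTarget_inter x hS
  -- Tested against the density restricted to the image of `S`, the multiplicity formula computes
  -- the area of the chain in `S`.
  set g : ℝ × ℝ → ℝ := (coord x '' S).indicator (chartDensity Ω x) with hg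
  have hgm : Measurable g := by
    classical
    rw [hg, ← piecewise_eq_indicator]
    exact ((contDiffOn_chartDensity Ω x).continuousOn.mono
      (hSB.trans (hBR.trans hBx))).measurable_piecewise continuousOn_const hSm
  have hgb : ∃ C, ∀ y, ‖g y‖ ≤ C := by
    obtain ⟨C, hC⟩ := (isCompact_closedBall y₀ ε).exists_bound_of_continuousOn
      ((contDiffOn_chartDensity Ω x).continuousOn.mono hKx)
    refine ⟨|C|, fun y ↦ ?_⟩
    by_cases hy : y ∈ coord x '' S
    · rw [hg, indicator_of_mem hy]
      exact (hC y (hBK (hBR (hSB hy)))).trans (le_abs_self C)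
    · rw [hg, indicator_of_notMem hy, norm_zero]
      exact abs_nonneg C
  have hΛ : chainArea Ω Z S = ∫ y, g y * Nt y := by
    rw [← hsum g hgm hgb, chainArea]
    refine chainHom_congr fun q hq ↦ ?_
    have hOm := (isOpen_chartDomain (x := x) (hZ q hq) hB).measurableSet
    have hsub : openSquare ∩ extendSquare q ⁻¹' S ⊆ chartDomain x q B := fun p hp ↦
      ⟨hp.1, hSx hp.2, hBR (hSW hp.2).2⟩
    have hTm : MeasurableSet (openSquare ∩ extendSquare q ⁻¹' S) :=
      isOpen_openSquare.measurableSet.inter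
        ((continuous_extendSquare (hZ q hq)).measurable hS)
    rw [setIntegral_eq_of_subset_of_forall_sdiff_eq_zero hOm hsub]
    · refine setIntegral_congr_fun hTm fun p hp ↦ ?_
      have hm : coord x (extendSquare q p) ∈ coord x '' S := ⟨_, hp.2, rfl⟩
      rw [hg, indicator_of_mem hm, pullDensity_extendSquare Ω (hZ q hq)
        (hsub hp)]
    · rintro p ⟨hp, hpS⟩
      rw [hg, indicator_of_notMem, zero_mul]
      rintro ⟨m, hm, hmp⟩
      refine hpS ⟨hp.1, ?_⟩
      rw [mem_preimage, ← coordInv_coord hp.2.1, ← hmp, coordInv_coord (hSx hm)]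
      exact hm
  rw [hΛ, ← setIntegral_abs_chartDensity Ω hS hSx, ← integral_const_mul, ← integral_indicator hSm]
  refine integral_congr_ae ?_
  filter_upwards [hy₁] with y hy
  by_cases hyS : y ∈ coord x '' S
  · rw [hg, indicator_of_mem hyS, indicator_of_mem hyS, hy (hSB hyS), hk]
    push_cast
    conv_lhs => rw [hσ y (hBR (hSB hyS))]
    ring
  · rw [hg, indicator_of_notMem hyS, indicator_of_notMem hyS, zero_mul]

/-- The area of a chain with degenerate boundary is an integer. -/
theorem exists_int_eq_chainIntegral [T2Space M] [CompactSpace M] [PreconnectedSpace M]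
    (Ω : AreaForm M) (harea : areaMeasure Ω univ = 1) {Z : Chain₂ M}
    (hZ : ∀ q ∈ Z.support, IsC1Square q) (hbd : boundary₂ Z ∈ degenerate₁ M) :
    ∃ k : ℤ, chainIntegral Ω Z = k := by
  have : IsFiniteMeasure (areaMeasure Ω) := ⟨by rw [harea]; exact ENNReal.one_lt_top⟩
  obtain ⟨k, hk⟩ := exists_int_mul_measure (areaMeasure Ω)
    (fun W hW hne ↦ areaMeasure_pos_of_isOpen Ω hW hne) (chainArea Ω Z) (fun T V hT hV ↦ by
      simp only [chainArea]
      rw [chainHom_apply, chainHom_apply, chainHom_apply, ← Finsupp.sum_add]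
      refine Finsupp.sum_congr fun q hq ↦ ?_
      have hqm := (continuous_extendSquare (hZ q hq)).measurable
      rw [← mul_add, ← setIntegral_union]
      · rw [← inter_union_distrib_left, ← preimage_union, inter_union_sdiff]
      · refine Disjoint.mono inter_subset_right inter_subset_right (Disjoint.preimage _ ?_)
        exact disjoint_sdiff_right.mono_left inter_subset_right
      · exact isOpen_openSquare.measurableSet.inter (hqm (hT.diff hV))
      · exact (integrableOn_pullDensity Ω (hZ q hq)).mono_set inter_subset_left
      · exact (integrableOn_pullDensity Ω (hZ q hq)).mono_set inter_subset_left)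
    (exists_chainArea_eq Ω hZ hbd)
  refine ⟨k, ?_⟩
  have h1 : chainIntegral Ω Z = chainArea Ω Z univ := by
    rw [chainIntegral, ← chainHom_apply, chainArea]
    congr 2
    ext q
    rw [preimage_univ, inter_univ, squareIntegral_eq]
  rw [h1, hk, Measure.real, harea]
  simp

end Multiplicity

/-! ### Regularity of the Hamiltonian flow -/

section HamiltonianFlow

variable {M : Type*} [TopologicalSpace M] [ChartedSpace Plane M] [IsManifold (𝓡 2) ∞ M]

/-- A vector in coordinates whose contraction with the area form is the differential of `h`
represents the Hamiltonian vector field of `h`. -/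
theorem tder_coordInv_eq_hamiltonianVectorField (Ω : AreaForm M) {x : M} {u : ℝ × ℝ}
    (hu : u ∈ coordTarget x) {h : M → ℝ}
    (hh : MDifferentiableAt (𝓡 2) 𝓘(ℝ, ℝ) h (coordInv x u)) {X : ℝ × ℝ}
    (hX : ∀ z : ℝ × ℝ, chartDensity Ω x u * (z.1 * X.2 - z.2 * X.1) =
      fderiv ℝ (fun u ↦ h (coordInv x u)) u z) :
    tder (coordInv x) u X = hamiltonianVectorField Ω h (coordInv x u) := by
  set A : ℝ × ℝ →L[ℝ] Plane := tder (coordInv x) u with hA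
  have hsurj : ∀ w, ∃ z, A z = w := fun w ↦ by
    have := tder_coordInv_coordDer (coordInv_mem_coordSource hu) w
    rw [coord_coordInv hu] at this
    exact ⟨_, this⟩
  have hder : ∀ z, fderiv ℝ (fun u ↦ h (coordInv x u)) u z =
      (mfderiv (𝓡 2) 𝓘(ℝ, ℝ) h (coordInv x u) : Plane →L[ℝ] ℝ) (A z) := fun z ↦ by
    have := mfderiv_comp u hh (mdifferentiableAt_coordInv hu)
    rw [mfderiv_eq_fderiv] at this
    exact DFunLike.congr_fun this z
  have hform : ∀ z, areaAt Ω (coordInv x u) (A z) (A X) =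
      chartDensity Ω x u * (z.1 * X.2 - z.2 * X.1) := fun z ↦ by
    have h0 : ∀ v, areaAt Ω (coordInv x u) v v = 0 := Ω.alternating (coordInv x u)
    have hsw : areaAt Ω (coordInv x u) (A (0, 1)) (A (1, 0)) =
        -areaAt Ω (coordInv x u) (A (1, 0)) (A (0, 1)) := Ω.neg_flip _ _ _
    have hdec : ∀ z : ℝ × ℝ, A z = z.1 • A (1, 0) + z.2 • A (0, 1) := fun z ↦ by
      rw [← map_smul, ← map_smul, ← map_add]; simp
    rw [chartDensity, pullDensity, ← hA, hdec z, hdec X]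
    simp only [map_add, map_smul, add_apply, smul_apply, smul_eq_mul, h0, hsw]
    ring
  set V : Plane := hamiltonianVectorField Ω h (coordInv x u) with hV
  have key : ∀ v : Plane, areaAt Ω (coordInv x u) v (A X - V) = 0 := fun v ↦ by
    obtain ⟨z, rfl⟩ := hsurj v
    rw [map_sub, hform, hX, hder]
    exact sub_eq_zero.2 (apply_hamiltonianVectorField Ω h (coordInv x u) (A z)).symm
  have hz : A X - V = 0 := Ω.nondegenerate (coordInv x u) (A X - V) fun w ↦
    (Ω.neg_flip (coordInv x u) (A X - V) w).trans (neg_eq_zero.2 (key w))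
  exact sub_eq_zero.1 hz

/-- The Hamiltonian vector field on `M × ℝ`, with unit speed in the time direction. -/
def suspendedField (Ω : AreaForm M) (H : M × ℝ → ℝ) (z : M × ℝ) :
    TangentSpace ((𝓡 2).prod 𝓘(ℝ, ℝ)) z :=
  ((hamiltonianVectorField Ω (fun y ↦ H (y, z.2)) z.1, 1) : Plane × ℝ)

/-- In a chart the field is built from first derivatives of `H` divided by the smooth nonvanishing
density, which costs one derivative. -/
theorem contMDiff_suspendedField (Ω : AreaForm M) {H : M × ℝ → ℝ}
    (hH : ContMDiff ((𝓡 2).prod 𝓘(ℝ, ℝ)) 𝓘(ℝ, ℝ) 2 H) :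
    haveI : IsManifold (𝓡 2) 1 M := IsManifold.of_le (n := ∞) (by simp)
    ContMDiff ((𝓡 2).prod 𝓘(ℝ, ℝ)) ((𝓡 2).prod 𝓘(ℝ, ℝ)).tangent 1
      (fun z ↦ (⟨z, suspendedField Ω H z⟩ : TangentBundle ((𝓡 2).prod 𝓘(ℝ, ℝ)) (M × ℝ))) := by
  have : IsManifold (𝓡 2) 1 M := IsManifold.of_le (n := ∞) (by simp)
  have : IsManifold (𝓡 2) (1 + 1) M := IsManifold.of_le (n := ∞) (by norm_cast)
  intro z₀
  set x := z₀.1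
  set T : Set ((ℝ × ℝ) × ℝ) := coordTarget x ×ˢ univ with hT
  have hTo : IsOpen T := (isOpen_coordTarget x).prod isOpen_univ
  set Ψ : (ℝ × ℝ) × ℝ → M × ℝ := fun p ↦ (coordInv x p.1, p.2) with hΨ
  have hΨs : ContMDiffOn 𝓘(ℝ, (ℝ × ℝ) × ℝ) ((𝓡 2).prod 𝓘(ℝ, ℝ)) ∞ Ψ T :=
    ((contMDiffOn_coordInv x).comp contDiff_fst.contMDiff.contMDiffOn fun p hp ↦ hp.1).prodMk
      contDiff_snd.contMDiff.contMDiffOn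
  set G : (ℝ × ℝ) × ℝ → ℝ := fun p ↦ H (Ψ p) with hG
  have hGs : ContDiffOn ℝ 2 G T :=
    (hH.comp_contMDiffOn (hΨs.of_le (by norm_cast))).contDiffOn
  have hσ : ContDiffOn ℝ 1 (fun p : (ℝ × ℝ) × ℝ ↦ chartDensity Ω x p.1) T :=
    ((contDiffOn_chartDensity Ω x).of_le (by simp)).comp contDiff_fst.contDiffOn fun p hp ↦ hp.1
  have hG' : ∀ e, ContDiffOn ℝ 1 (fun p ↦ fderiv ℝ G p e) T := fun e ↦
    (hGs.fderiv_of_isOpen hTo le_rfl).clm_apply contDiffOn_const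
  -- The solution `X` of `σ (z₁ X₂ - z₂ X₁) = dG(z)` for all `z`, where `σ` is the chart density,
  -- with time component 1.
  set w : (ℝ × ℝ) × ℝ → (ℝ × ℝ) × ℝ := fun p ↦
    ((-(fderiv ℝ G p ((0, 1), 0)) / chartDensity Ω x p.1,
      fderiv ℝ G p ((1, 0), 0) / chartDensity Ω x p.1), 1) with hw
  have hws : ContDiffOn ℝ 1 w T := by
    have hne : ∀ p ∈ T, chartDensity Ω x p.1 ≠ 0 := fun p hp ↦ chartDensity_ne_zero Ω hp.1
    exact (((hG' _).neg.div hσ hne).prodMk ((hG' _).div hσ hne)).prodMk contDiffOn_const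
  have hsec := contMDiffOn_mfderivWithin_apply (I := (𝓡 2).prod 𝓘(ℝ, ℝ)) (n := 1) (q := Ψ) (s := T)
    (hΨs.of_le (by norm_cast)) hTo.uniqueDiffOn hws
  have hval : ∀ p ∈ T, (mfderivWithin 𝓘(ℝ, (ℝ × ℝ) × ℝ) ((𝓡 2).prod 𝓘(ℝ, ℝ)) Ψ T p (w p)) =
      suspendedField Ω H (Ψ p) := by
    intro p hp
    have h1 : HasMFDerivAt 𝓘(ℝ, (ℝ × ℝ) × ℝ) (𝓡 2) (fun p : (ℝ × ℝ) × ℝ ↦ coordInv x p.1) p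
        ((tder (coordInv x) p.1).comp (ContinuousLinearMap.fst ℝ (ℝ × ℝ) ℝ)) :=
      (mdifferentiableAt_coordInv hp.1).hasMFDerivAt.comp p
        (hasFDerivAt_fst (𝕜 := ℝ) (p := p)).hasMFDerivAt
    have h2 : HasMFDerivAt 𝓘(ℝ, (ℝ × ℝ) × ℝ) 𝓘(ℝ, ℝ) (fun p : (ℝ × ℝ) × ℝ ↦ p.2) p
        (ContinuousLinearMap.snd ℝ (ℝ × ℝ) ℝ) :=
      (hasFDerivAt_snd (𝕜 := ℝ) (p := p)).hasMFDerivAt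
    have h3 := (h1.prodMk h2).mfderiv
    have hHd : MDifferentiableAt (𝓡 2) 𝓘(ℝ, ℝ) (fun y ↦ H (y, p.2)) (coordInv x p.1) :=
      ((hH.comp (contMDiff_id.prodMk contMDiff_const)).mdifferentiable two_ne_zero) _
    have hXe : tder (coordInv x) p.1 (w p).1 =
        hamiltonianVectorField Ω (fun y ↦ H (y, p.2)) (coordInv x p.1) := by
      refine tder_coordInv_eq_hamiltonianVectorField Ω hp.1 hHd fun z ↦ ?_
      have hne := chartDensity_ne_zero Ω hp.1
      have hGd : HasFDerivAt G (fderiv ℝ G p) p :=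
        ((hGs.contDiffAt (hTo.mem_nhds hp)).differentiableAt two_ne_zero).hasFDerivAt
      have h4 : HasFDerivAt (fun u : ℝ × ℝ ↦ (u, p.2)) (ContinuousLinearMap.inl ℝ (ℝ × ℝ) ℝ) p.1 :=
        hasFDerivAt_prodMk_left p.1 p.2
      have h5 : fderiv ℝ (fun u ↦ H (coordInv x u, p.2)) p.1 =
          (fderiv ℝ G p).comp (ContinuousLinearMap.inl ℝ (ℝ × ℝ) ℝ) :=
        (HasFDerivAt.comp (g := G) p.1 hGd h4).fderiv
      have hdec : fderiv ℝ G p (z, 0) =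
          z.1 * fderiv ℝ G p ((1, 0), 0) + z.2 * fderiv ℝ G p ((0, 1), 0) := by
        rw [← smul_eq_mul, ← smul_eq_mul, ← map_smul, ← map_smul, ← map_add]; simp
      rw [h5, ContinuousLinearMap.comp_apply, ContinuousLinearMap.inl_apply, hdec]
      simp only [hw]
      field_simp
      ring
    rw [mfderivWithin_of_mem_nhds (hTo.mem_nhds hp), h3]
    exact Prod.ext hXe rfl
  set Φ : M × ℝ → (ℝ × ℝ) × ℝ := fun z ↦ (coord x z.1, z.2) with hΦ
  have hx : z₀.1 ∈ coordSource x := mem_coordSource x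
  have hΦs : ContMDiffAt ((𝓡 2).prod 𝓘(ℝ, ℝ)) 𝓘(ℝ, (ℝ × ℝ) × ℝ) 1 Φ z₀ := by
    have h1 : ContMDiffAt ((𝓡 2).prod 𝓘(ℝ, ℝ)) 𝓘(ℝ, ℝ × ℝ) 1 (fun z : M × ℝ ↦ coord x z.1) z₀ :=
      (((contMDiffOn_coord x).contMDiffAt ((isOpen_coordSource x).mem_nhds hx)).of_le
        (by simp)).comp z₀ contMDiffAt_fst
    exact h1.prodMk_space contMDiffAt_snd
  have hΦT : Φ z₀ ∈ T := ⟨coord_mem_coordTarget hx, mem_univ _⟩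
  have hcomp := ((hsec (Φ z₀) hΦT).contMDiffAt (hTo.mem_nhds hΦT)).comp z₀ hΦs
  refine hcomp.congr_of_eventuallyEq ?_
  have hmem : ∀ᶠ z in 𝓝 z₀, z.1 ∈ coordSource x :=
    continuous_fst.continuousAt.eventually_mem ((isOpen_coordSource x).mem_nhds hx)
  filter_upwards [hmem] with z hz
  have hzT : Φ z ∈ T := ⟨coord_mem_coordTarget hz, mem_univ _⟩
  have hinv : Ψ (Φ z) = z := Prod.ext (coordInv_coord hz) rfl
  simp only [Function.comp_apply]
  rw [hval _ hzT, hinv]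

/-- Joined with the clock `t₀ + τ`, trajectories become integral curves of the autonomous `C¹` field
`suspendedField` on `M × ℝ`. -/
theorem contMDiff_of_isHamiltonianFlow [T2Space M] {Ω : AreaForm M} {H : M × ℝ → ℝ}
    (hH : ContMDiff ((𝓡 2).prod 𝓘(ℝ, ℝ)) 𝓘(ℝ, ℝ) 2 H) {t₀ : ℝ} {φ : ℝ → M → M}
    (hφ : IsHamiltonianFlow Ω H t₀ φ) :
    ContMDiff (𝓘(ℝ, ℝ).prod (𝓡 2)) (𝓡 2) 1 (fun z : ℝ × M ↦ φ z.1 z.2) := by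
  have : IsManifold (𝓡 2) 1 M := IsManifold.of_le (n := ∞) (by simp)
  have h := contMDiff_of_isMIntegralCurve (J := 𝓡 2) (contMDiff_suspendedField Ω hH)
    (Γ := fun τ x ↦ (φ τ x, t₀ + τ)) (by
      simp only [hφ.1]
      exact contMDiff_id.prodMk contMDiff_const) (fun x t ↦ by
      have h1 : HasMFDerivAt 𝓘(ℝ, ℝ) 𝓘(ℝ, ℝ) (fun τ : ℝ ↦ t₀ + τ) t (ContinuousLinearMap.id ℝ ℝ) :=
        ((hasFDerivAt_id t).const_add t₀).hasMFDerivAt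
      have h2 := (hφ.2 x t).prodMk h1
      refine h2.congr_mfderiv (ContinuousLinearMap.ext fun c ↦ Prod.ext rfl ?_)
      exact (mul_one (M := ℝ) c).symm)
  exact contMDiff_fst.comp h

end HamiltonianFlow

/-! ### The filling swept out by the flow -/

section TraceOfFlow

theorem chainHom_mapDomain {X Y : Type*} (F : Y → ℝ) (g : X → Y) (c : X →₀ ℤ) :
    chainHom F (c.mapDomain g) = chainHom (fun x ↦ F (g x)) c := by
  change ((chainHom F).comp (Finsupp.mapDomain.addMonoidHom g)) c = _
  congr 1
  refine Finsupp.addHom_ext fun x n ↦ ?_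
  simp [chainHom_single, Finsupp.mapDomain_single]

/-- Green's theorem for `A dt`. -/
theorem integral_fderivWithin_fst {A : ℝ × ℝ → ℝ} (cA : Continuous A)
    (hA : ContDiffOn ℝ 1 A square) :
    ∫ p in square, fderivWithin ℝ A square p (1, 0) =
      (∫ t in (0 : ℝ)..1, A (1, t)) - ∫ t in (0 : ℝ)..1, A (0, t) := by
  have hcont : ∀ w : ℝ × ℝ, Continuous fun p ↦ fderivWithin ℝ A square (clampSquare p) w := fun w ↦
    ((hA.continuousOn_fderivWithin uniqueDiffOn_square le_rfl).comp_continuous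
      continuous_clampSquare clampSquare_mem).clm_apply continuous_const
  have key := integral_wedge_eq_boundary (A := A) (B := Prod.snd) (Bs := fun _ ↦ 0)
    (Bt := fun _ ↦ 1) cA continuous_snd (hcont (1, 0)) (hcont (0, 1))
    continuous_const continuous_const
    (fun s hs t ht ↦ by
      rw [clampSquare_of_mem ⟨Ioo_subset_Icc_self hs, ht⟩]
      exact hasDerivAt_fst_of_contDiffOn_square hA hs ht)
    (fun s _ t _ ↦ hasDerivAt_const s t)
    (fun s hs t ht ↦ by
      rw [clampSquare_of_mem ⟨hs, Ioo_subset_Icc_self ht⟩]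
      exact hasDerivAt_snd_of_contDiffOn_square hA hs ht)
    (fun s _ t _ ↦ hasDerivAt_id t)
  simp only [mul_one, mul_zero, sub_zero, intervalIntegral.integral_zero, zero_add] at key
  rw [← key]
  refine setIntegral_congr_fun (measurableSet_Icc.prod measurableSet_Icc) fun p hp ↦ ?_
  simp only [clampSquare_of_mem hp]

/-- The square swept out by a curve under the flow `φ`, from time one back to time zero. -/
def sweep {M : Type*} (φ : ℝ → M → M) (γ : unitInterval → M) (p : unitInterval × unitInterval) : M :=
  φ (1 - p.2) (γ p.1)

/-- The lateral edges form the image of `∂c` under the map `τ` from points to trajectories, so they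
cancel exactly, with no appeal to degenerate chains. Reversed time gives `f(c) - c` its sign. -/
theorem boundary₂_mapDomain_sweep {M : Type*} {φ : ℝ → M → M} (h0 : ∀ x, φ 0 x = x) {c : Chain₁ M}
    (hc : boundary₁ c = 0) :
    boundary₂ (c.mapDomain (sweep φ)) = pushforward₁ (φ 1) c - c := by
  let τ : M → unitInterval → M := fun x t ↦ φ (1 - t) x
  have h : boundary₂.comp (Finsupp.mapDomain.addMonoidHom (sweep φ)) =
      Finsupp.mapDomain.addMonoidHom (fun γ ↦ φ 1 ∘ γ) - AddMonoidHom.id (Chain₁ M) +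
        (Finsupp.mapDomain.addMonoidHom τ).comp boundary₁ := by
    refine Finsupp.addHom_ext fun γ n ↦ ?_
    simp only [AddMonoidHom.comp_apply, AddMonoidHom.add_apply, AddMonoidHom.sub_apply,
      AddMonoidHom.id_apply, Finsupp.mapDomain.addMonoidHom_apply, Finsupp.mapDomain_single,
      boundary₂, boundary₁, Finsupp.liftAddHom_apply_single, Finsupp.singleAddHom_apply]
    rw [← Finsupp.mapDomain.addMonoidHom_apply τ, map_sub]
    simp only [Finsupp.mapDomain.addMonoidHom_apply, Finsupp.mapDomain_single]
    have h1 : (fun s ↦ sweep φ γ (s, 0)) = φ 1 ∘ γ := by ext s; simp [sweep]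
    have h2 : (fun s ↦ sweep φ γ (s, 1)) = γ := by ext s; simp [sweep, h0]
    rw [h1, h2, show (fun t ↦ sweep φ γ (1, t)) = τ (γ 1) from rfl,
      show (fun t ↦ sweep φ γ (0, t)) = τ (γ 0) from rfl]
    abel
  have := DFunLike.congr_fun h c
  simpa [hc, pushforward₁] using this

theorem extendSquare_sweep {M : Type*} {φ : ℝ → M → M} (γ : unitInterval → M) {p : ℝ × ℝ} (hp : p ∈ square) :
    extendSquare (sweep φ γ) p = φ (1 - p.2) (IccExtend zero_le_one γ p.1) := by
  simp [extendSquare, sweep, IccExtend, projIcc_of_mem zero_le_one hp.2]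

variable {M : Type*} [TopologicalSpace M] [ChartedSpace Plane M]

theorem isC1Square_sweep {φ : ℝ → M → M}
    (hφ : ContMDiff (𝓘(ℝ, ℝ).prod (𝓡 2)) (𝓡 2) 1 (fun z : ℝ × M ↦ φ z.1 z.2))
    {γ : unitInterval → M} (hγ : IsC1Curve γ) : IsC1Square (sweep φ γ) := by
  have h1 : ContMDiffOn 𝓘(ℝ, ℝ × ℝ) 𝓘(ℝ, ℝ) 1 (fun p : ℝ × ℝ ↦ 1 - p.2) square :=
    (contDiff_const.sub contDiff_snd).contMDiff.contMDiffOn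
  have h2 : ContMDiffOn 𝓘(ℝ, ℝ × ℝ) (𝓡 2) 1 (fun p : ℝ × ℝ ↦ IccExtend zero_le_one γ p.1) square :=
    ContMDiffOn.comp (t := Icc (0 : ℝ) 1) hγ contDiff_fst.contMDiff.contMDiffOn fun p hp ↦ hp.1
  exact (hφ.comp_contMDiffOn (h1.prodMk h2)).congr fun p hp ↦ extendSquare_sweep γ hp

variable [IsManifold (𝓡 2) ∞ M]

/-- Along the sweep `∂Q/∂t` is minus the Hamiltonian field at time `t₀ + (1 - t)`. As this time does
not depend on `s`, contracting with `∂Q/∂s` gives minus the `s`-derivative of `H` along `Q`. -/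
theorem pullDensity_sweep {Ω : AreaForm M} {H : M × ℝ → ℝ}
    (hH : ContMDiff ((𝓡 2).prod 𝓘(ℝ, ℝ)) 𝓘(ℝ, ℝ) 1 H) {t₀ : ℝ} {φ : ℝ → M → M}
    (hφ : IsHamiltonianFlow Ω H t₀ φ) {γ : unitInterval → M} (hq : IsC1Square (sweep φ γ))
    {A : ℝ × ℝ → ℝ} (hA : ContDiffOn ℝ 1 A square)
    (hAq : ∀ p, A p = H (extendSquare (sweep φ γ) p, t₀ + (1 - p.2)))
    {p : ℝ × ℝ} (hp : p ∈ openSquare) :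
    pullDensity Ω (extendSquare (sweep φ γ)) p = -fderivWithin ℝ A square p (1, 0) := by
  set Q := extendSquare (sweep φ γ) with hQ
  set h : M → ℝ := fun y ↦ H (y, t₀ + (1 - p.2)) with hh
  have hQd : HasMFDerivAt 𝓘(ℝ, ℝ × ℝ) (𝓡 2) Q p (tder Q p) :=
    ((contMDiffAt_extendSquare hq hp).mdifferentiableAt one_ne_zero).hasMFDerivAt
  have hhd : MDifferentiableAt (𝓡 2) 𝓘(ℝ, ℝ) h (Q p) :=
    ((hH.comp (contMDiff_id.prodMk contMDiff_const)).mdifferentiable one_ne_zero) _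
  have hs : HasFDerivAt (fun s : ℝ ↦ (s, p.2)) (ContinuousLinearMap.inl ℝ ℝ ℝ) p.1 :=
    hasFDerivAt_prodMk_left p.1 p.2
  have ht : HasFDerivAt (fun t : ℝ ↦ (p.1, t)) (ContinuousLinearMap.inr ℝ ℝ ℝ) p.2 :=
    hasFDerivAt_prodMk_right p.1 p.2
  set dh : Plane →L[ℝ] ℝ := mfderiv (𝓡 2) 𝓘(ℝ, ℝ) h (Q p) with hdh
  have hdhd : HasMFDerivAt (𝓡 2) 𝓘(ℝ, ℝ) h (Q p) dh := hhd.hasMFDerivAt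
  have hspace : fderivWithin ℝ A square p (1, 0) =
      dh (tder Q p (1, 0)) := by
    have h1 := hasDerivAt_fst_of_contDiffOn_square hA hp.1 (Ioo_subset_Icc_self hp.2)
    have h2 : HasMFDerivAt 𝓘(ℝ, ℝ) 𝓘(ℝ, ℝ) (fun s ↦ h (Q (s, p.2))) p.1
        ((dh.comp (tder Q p)).comp
          (ContinuousLinearMap.inl ℝ ℝ ℝ)) :=
      HasMFDerivAt.comp (I' := 𝓘(ℝ, ℝ × ℝ)) (g := fun p ↦ h (Q p)) p.1
        (hdhd.comp p hQd) hs.hasMFDerivAt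
    have h3 : HasFDerivAt (fun s ↦ h (Q (s, p.2)))
        ((dh.comp (tder Q p)).comp
          (ContinuousLinearMap.inl ℝ ℝ ℝ)) p.1 := h2.hasFDerivAt
    have h4 : (fun s ↦ A (s, p.2)) = fun s ↦ h (Q (s, p.2)) := by
      ext s; rw [hAq]
    rw [h4] at h1
    exact h1.unique h3.hasDerivAt
  set V : Plane := hamiltonianVectorField Ω h (Q p) with hV
  have htime : tder Q p (0, 1) = -V := by
    have h1 : HasMFDerivAt 𝓘(ℝ, ℝ) (𝓡 2) (fun t ↦ Q (p.1, t)) p.2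
        ((tder Q p).comp (ContinuousLinearMap.inr ℝ ℝ ℝ)) :=
      HasMFDerivAt.comp (I' := 𝓘(ℝ, ℝ × ℝ)) (g := Q) p.2 hQd ht.hasMFDerivAt
    have h2 : HasFDerivAt (fun t : ℝ ↦ 1 - t) (-ContinuousLinearMap.id ℝ ℝ) p.2 :=
      (hasFDerivAt_id p.2).const_sub 1
    have h3 := (hφ.2 (IccExtend zero_le_one γ p.1) (1 - p.2)).comp p.2 h2.hasMFDerivAt
    have h4 : (fun t ↦ Q (p.1, t)) =ᶠ[𝓝 p.2]
        (fun τ ↦ φ τ (IccExtend zero_le_one γ p.1)) ∘ fun t : ℝ ↦ 1 - t := by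
      filter_upwards [Icc_mem_nhds hp.2.1 hp.2.2] with t ht
      exact extendSquare_sweep γ ⟨Ioo_subset_Icc_self hp.1, ht⟩
    have h5 := hasMFDerivAt_unique h1 (h3.congr_of_eventuallyEq h4)
    have h6 := DFunLike.congr_fun h5 (1 : ℝ)
    have h7 : Q p = φ (1 - p.2) (IccExtend zero_le_one γ p.1) :=
      extendSquare_sweep γ (openSquare_subset hp)
    rw [hV, h7]
    exact h6.trans (neg_one_smul ℝ (_ : Plane))
  rw [hspace, pullDensity, htime, map_neg]
  exact congrArg Neg.neg (apply_hamiltonianVectorField Ω h (Q p) (tder Q p (1, 0)))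

theorem squareIntegral_sweep {Ω : AreaForm M} {H : M × ℝ → ℝ}
    (hH : ContMDiff ((𝓡 2).prod 𝓘(ℝ, ℝ)) 𝓘(ℝ, ℝ) 1 H) {t₀ : ℝ} {φ : ℝ → M → M}
    (hφ : IsHamiltonianFlow Ω H t₀ φ) {γ : unitInterval → M} (hq : IsC1Square (sweep φ γ)) :
    squareIntegral Ω (sweep φ γ) =
      (-∫ t in (0 : ℝ)..1, H (φ (1 - t) (γ 1), t₀ + (1 - t))) -
        -∫ t in (0 : ℝ)..1, H (φ (1 - t) (γ 0), t₀ + (1 - t)) := by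
  set A : ℝ × ℝ → ℝ := fun p ↦ H (extendSquare (sweep φ γ) p, t₀ + (1 - p.2)) with hAdef
  have cA : Continuous A := hH.continuous.comp ((continuous_extendSquare hq).prodMk (by fun_prop))
  have hA : ContDiffOn ℝ 1 A square := by
    have h1 : ContMDiffOn 𝓘(ℝ, ℝ × ℝ) 𝓘(ℝ, ℝ) 1 (fun p : ℝ × ℝ ↦ t₀ + (1 - p.2)) square :=
      (contDiff_const.add (contDiff_const.sub contDiff_snd)).contMDiff.contMDiffOn
    exact (hH.comp_contMDiffOn
      (ContMDiffOn.prodMk (show ContMDiffOn _ _ _ _ _ from hq) h1)).contDiffOn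
  have hend : ∀ s : unitInterval, ∫ t in (0 : ℝ)..1, A (s, t) =
      ∫ t in (0 : ℝ)..1, H (φ (1 - t) (γ s), t₀ + (1 - t)) := fun s ↦ by
    refine intervalIntegral.integral_congr fun t ht ↦ ?_
    rw [uIcc_of_le zero_le_one] at ht
    simp only [hAdef]
    rw [extendSquare_sweep γ ⟨s.2, ht⟩, IccExtend_val]
  have h1 := hend 1
  have h0 := hend 0
  simp only [Icc.coe_one, Icc.coe_zero] at h1 h0
  rw [squareIntegral_eq, setIntegral_congr_fun isOpen_openSquare.measurableSet fun p hp ↦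
    pullDensity_sweep hH hφ hq hA (fun _ ↦ rfl) hp, integral_neg,
    ← setIntegral_congr_set ae_eq_openSquare, integral_fderivWithin_fst cA hA, h1, h0]
  ring

/-- The area of each square is the difference at the end points of `γ` of one function on `M`, so
the total is that function evaluated on `∂c = 0`. -/
theorem chainIntegral_mapDomain_sweep {Ω : AreaForm M} {H : M × ℝ → ℝ}
    (hH : ContMDiff ((𝓡 2).prod 𝓘(ℝ, ℝ)) 𝓘(ℝ, ℝ) 1 H) {t₀ : ℝ} {φ : ℝ → M → M}
    (hφ : IsHamiltonianFlow Ω H t₀ φ) {c : Chain₁ M} (hc : boundary₁ c = 0)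
    (hq : ∀ γ ∈ c.support, IsC1Square (sweep φ γ)) :
    chainIntegral Ω (c.mapDomain (sweep φ)) = 0 := by
  rw [chainIntegral, ← chainHom_apply, chainHom_mapDomain,
    chainHom_congr fun γ hγ ↦ squareIntegral_sweep hH hφ (hq γ hγ),
    ← chainHom_boundary₁ (fun x ↦ -∫ t in (0 : ℝ)..1, H (φ (1 - t) x, t₀ + (1 - t))), hc, map_zero]

end TraceOfFlow

end SurfaceFlux

end

/-! ### The flux theorem -/

theorem mainTheorem5 {M : Type*} [TopologicalSpace M] [T2Space M] [CompactSpace M]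
    [ConnectedSpace M] [ChartedSpace SurfaceFlux.Plane M] [IsManifold (𝓡 2) ∞ M]
    [MeasurableSpace M] [BorelSpace M]
    (Ω : SurfaceFlux.AreaForm M) (harea : SurfaceFlux.areaMeasure Ω Set.univ = 1)
    (r : ℕ∞) (hr : 1 ≤ r) (f : M → M) (hf : SurfaceFlux.IsHamiltonianDiffeo Ω r f)
    (c : SurfaceFlux.Chain₁ M) (hc : SurfaceFlux.IsC1Cycle c) :
    SurfaceFlux.HasFlux Ω f c 0 := by
  classical
  obtain ⟨H, t₀, φ, hH, -, hφ, rfl⟩ := hf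
  -- With `r ≥ 1` the Hamiltonian is `C²`, which makes its field and flow `C¹`.
  have hr2 : (2 : WithTop ℕ∞) ≤ ((r + 1 : ℕ∞) : WithTop ℕ∞) := by
    have : (2 : ℕ∞) ≤ r + 1 := by
      rw [← one_add_one_eq_two]
      gcongr
    exact WithTop.coe_le_coe.2 this
  have hH2 := hH.of_le hr2
  have hφC := SurfaceFlux.contMDiff_of_isHamiltonianFlow hH2 hφ
  have hsq : ∀ γ ∈ c.support, SurfaceFlux.IsC1Square (SurfaceFlux.sweep φ γ) := fun γ hγ ↦
    SurfaceFlux.isC1Square_sweep hφC (hc.1 γ hγ)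
  have hsupp : ∀ q ∈ (c.mapDomain (SurfaceFlux.sweep φ)).support, SurfaceFlux.IsC1Square q := by
    intro q hq
    obtain ⟨γ, hγ, rfl⟩ := Finset.mem_image.1 (Finsupp.mapDomain_support hq)
    exact hsq γ hγ
  have hbd := SurfaceFlux.boundary₂_mapDomain_sweep hφ.1 hc.2
  refine ⟨⟨c.mapDomain (SurfaceFlux.sweep φ), hsupp, ?_⟩, fun D hD ↦ ?_⟩
  · rw [hbd, sub_self]
    exact zero_mem _
  -- The difference of the two fillings has degenerate boundary, hence integral area, and the swept
  -- filling has area zero.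
  · obtain ⟨k, hk⟩ := SurfaceFlux.exists_int_eq_chainIntegral Ω harea
      (Z := D - c.mapDomain (SurfaceFlux.sweep φ))
      (fun q hq ↦ (Finset.mem_union.1 (Finsupp.support_sub hq)).elim (hD.1 q) (hsupp q))
      (by rw [map_sub, hbd]; exact hD.2)
    have h0 := SurfaceFlux.chainIntegral_mapDomain_sweep (hH2.of_le one_le_two) hφ hc.2 hsq
    rw [SurfaceFlux.chainIntegral, ← SurfaceFlux.chainHom_apply] at hk h0 ⊢
    rw [map_sub, h0, sub_zero] at hk
    rw [hk, AddCircle.coe_eq_zero_iff]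
    exact ⟨k, by simp⟩
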